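/- \textbf{Theorem (Sufficient condition).} Call $\tau:[0,\infty)\to[0,\infty)$ \emph{admissible} if it is nondecreasing, concave and continuous with $\tau(0)=0$, and extend such a $\tau$ by $-\infty$ to $(-\infty,0)$. Let $f^*(t)=\sup_{s\in\mathbb R}\,(st-f(s))$ denote the Legendre--Fenchel conjugate, let $[g*r](t)=\int_0^\infty g(s)\,r(t-s)\,\mathrm ds$ denote convolution, where $$r(s)=\begin{cases}\dfrac{2\sqrt2}{3\sqrt{-s}}&\text{if }s<0,\\[1ex]0&\text{otherwise,}\end{cases}$$ and for nonincreasing lower semicontinuous $g:[0,\infty)\to[0,\infty]$ let $g^{-1}(x)=\inf\{y\in[0,\infty)\mid g(y)\le x\}$, $x\in[0,\infty)$, be its generalized inverse ($\inf\emptyset=\infty$). For $z:[0,\infty)\to[0,\infty]$ put $c(\phi)=\phi\,z(\phi)$ (with $c(0)=0$) and $$\tau^z(w)=\inf\left\{\int_{\mathbb R}\tfrac12|\psi'(y)|^2+c(|\psi(y)|)\,\mathrm dy\;\middle|\;\int_{\mathbb R}\psi\,\mathrm dy=w\right\},\qquad w\ge0,$$ the infimum being over integrable, locally absolutely continuous $\psi:\mathbb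 R\to\mathbb R$. Let $\tau$ be admissible and let $g:[0,\infty)\to[0,\infty]$ be lower semicontinuous and nonincreasing with $$[-\tau(-\,\cdot\,)]^*(t)=[g*r](t)\quad\text{for all }t\ge0$$ (as an identity in $[0,\infty]$). Then $z(\phi)=g^{-1}(\phi^{3/2})$ induces exactly $\tau$, that is, $\tau(w)=\tau^z(w)$ for all $w\ge0$. -/

import Mathlib

open MeasureTheory Set
open scoped NNReal ENNReal

noncomputable section

/-- A transport cost `τ : [0,∞) → [0,∞)` is admissible if it is nondecreasing, concave and
continuous with `τ(0) = 0`. -/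
structure IsAdmissible (τ : ℝ≥0 → ℝ≥0) : Prop where
  monotone : Monotone τ
  concaveOn : ConcaveOn ℝ≥0 univ τ
  continuous : Continuous τ
  map_zero : τ 0 = 0

/-- The extension of a transport cost to the real line by `-∞` on `(-∞,0)`. -/
def extendByBot (τ : ℝ≥0 → ℝ≥0) (w : ℝ) : EReal :=
  if 0 ≤ w then ((τ w.toNNReal : ℝ) : EReal) else ⊥

/-- The Legendre–Fenchel conjugate `f^*(t) = sup_s (s t - f(s))` of an extended real valued
function on the real line. -/
def fenchelConjugate (f : ℝ → EReal) (t : ℝ) : EReal :=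
  ⨆ s : ℝ, ((s * t : ℝ) : EReal) - f s

/-- The convolution kernel `r(s) = 2√2 / (3√(-s))` for `s < 0` and `r(s) = 0` otherwise. -/
def convKernel (s : ℝ) : ℝ≥0∞ :=
  if s < 0 then ENNReal.ofReal (2 * Real.sqrt 2 / (3 * Real.sqrt (-s))) else 0

/-- Extension by zero of a function on `[0,∞)` to the real line. For `t ≥ 0` the value
`[g * r](t)` does not depend on how `g` is extended, since `r(t - s) = 0` for `s < 0`. -/
def extendByZero (g : ℝ≥0 → ℝ≥0∞) (s : ℝ) : ℝ≥0∞ :=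
  if 0 ≤ s then g s.toNNReal else 0

/-- `g` solves the deconvolution problem `[-τ(-·)]^*(t) = [g * r](t)` for all `t ≥ 0`;
both sides are allowed to be `+∞`. -/
def SolvesDeconvolution (τ : ℝ≥0 → ℝ≥0) (g : ℝ≥0 → ℝ≥0∞) : Prop :=
  ∀ t : ℝ, 0 ≤ t →
    fenchelConjugate (fun s => -extendByBot τ (-s)) t
      = ((lconvolution (extendByZero g) convKernel volume t : ℝ≥0∞) : EReal)

/-- The generalized inverse `h⁻¹(x) = inf {y ∈ [0,∞) | h(y) ≤ x}`, with `inf ∅ = ∞`. -/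
def genInverse (h : ℝ≥0 → ℝ≥0∞) (x : ℝ≥0) : ℝ≥0∞ :=
  ⨅ (y : ℝ≥0) (_ : h y ≤ (x : ℝ≥0∞)), (y : ℝ≥0∞)

/-- The phase field cost `c(φ) = φ z(φ)` of a mass-specific phase field cost `z`
(so that `c(0) = 0`, even if `z(0) = ∞`). -/
def phaseFieldCost (z : ℝ≥0 → ℝ≥0∞) (φ : ℝ≥0) : ℝ≥0∞ :=
  (φ : ℝ≥0∞) * z φ

/-- The phase field energy `F^c[ψ] = ∫ ½ |ψ'(y)|² + c(|ψ(y)|) dy`. -/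
def phaseFieldEnergy (c : ℝ≥0 → ℝ≥0∞) (ψ : ℝ → ℝ) : ℝ≥0∞ :=
  ∫⁻ y : ℝ, (ENNReal.ofReal ((1 / 2) * |deriv ψ y| ^ 2) + c ‖ψ y‖₊)

/-- The phase field functions of mass `w`: the integrable functions on the real line with total
integral `w` that are locally absolutely continuous (equivalently, the continuous representatives
of functions in `W^{1,1}_loc`; the classical derivative, which exists almost everywhere, is then
the weak one). -/
structure IsPhaseField (ψ : ℝ → ℝ) (w : ℝ) : Prop where
  locallyAbsolutelyContinuous : ∀ a b : ℝ, AbsolutelyContinuousOnInterval ψ a b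
  integrable : Integrable ψ
  mass : ∫ y, ψ y = w

/-- The transport cost `w ↦ inf {F^c[ψ] | ∫ ψ = w}` induced by the phase field cost `c`. -/
def inducedCost (c : ℝ≥0 → ℝ≥0∞) (w : ℝ≥0) : ℝ≥0∞ :=
  ⨅ (ψ : ℝ → ℝ) (_ : IsPhaseField ψ w), phaseFieldEnergy c ψ

/-- The transport cost `τ^z`, induced by the phase field cost `c(φ) = φ z(φ)`. -/
def inducedCostOfMassSpecific (z : ℝ≥0 → ℝ≥0∞) : ℝ≥0 → ℝ≥0∞ :=
  inducedCost (phaseFieldCost z)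

end

/-! Write V_t(x) = √(2x(z(x) - t)₊) for the speed with multiplier t (`profileSpeed`) and C(t) = 2
∫₀^∞ V_t(x) dx. A layer cake formula for the square root and Tonelli give C(t) = [g * r](t) for z =
g⁻¹(φ^{3/2}) (`two_mul_lintegral_profileSpeed_eq`), so the hypothesis says that C is the conjugate
of -τ(-·) on [0,∞). It remains to show that the optimal energy at mass w is the value of the dual
problem inf_t (C(t) + tw).

Lower bound: given ψ of finite energy, take t = inf z(|ψ|). Young's inequality bounds the energy
density below by V_t(|ψ|)|ψ'| + t|ψ|. As |ψ| rises from arbitrarily small values and returns to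
them, and V_t vanishes above the range of |ψ|, integration gives at least C(t) + tw
(`IsPhaseField.exists_le_phaseFieldEnergy`), which is at least τ(w) by weak duality
(`SolvesDeconvolution.le_add`).

Upper bound: for w > 0 let t be a supergradient of τ at w; then C(t) + tw ≤ τ(w)
(`SolvesDeconvolution.add_le`). A symmetric profile descending with speed V_t attains equality in
Young's inequality. Its mass 2 ∫ x/V_t is formally -C'(t), and minimality of s ↦ C(s) + sw at t
bounds it by w (`two_mul_lintegral_div_profileSpeed_le`). The missing mass goes into a plateau at
the top height Φ = g(t)^{2/3}, where z ≤ t, at cost at most t per unit mass.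
`exists_isPhaseField_of_speed` builds such profiles by rearrangement instead of solving an ODE. -/

/-! ### Change of variables for absolutely continuous functions. -/

namespace AbsolutelyContinuousOnInterval

theorem continuous_of_forall {ψ : ℝ → ℝ} (hψ : ∀ a b, AbsolutelyContinuousOnInterval ψ a b) :
    Continuous ψ := by
  rw [continuous_iff_continuousAt]
  intro x
  have h := (hψ (x - 1) (x + 1)).continuousOn
  refine h.continuousAt ?_
  rw [uIcc_of_le (by linarith)]
  exact Icc_mem_nhds (by linarith) (by linarith)

/-- Substitution rule for a bounded continuous integrand and an absolutely continuous inner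
function. -/
theorem integral_comp_mul_deriv {ψ : ℝ → ℝ} {a b : ℝ}
    (hψ : AbsolutelyContinuousOnInterval ψ a b) (f : BoundedContinuousFunction ℝ ℝ) :
    ∫ y in a..b, f (ψ y) * deriv ψ y = ∫ x in ψ a..ψ b, f x := by
  set G : ℝ → ℝ := fun u => ∫ x in (0 : ℝ)..u, f x with hG
  have hint : ∀ u v, IntervalIntegrable f volume u v := fun u v =>
    f.continuous.intervalIntegrable u v
  have hGd : ∀ u, HasDerivAt G (f u) u := fun u =>
    (f.continuous.integral_hasStrictDerivAt 0 u).hasDerivAt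
  have hGsub : ∀ u v, G v - G u = ∫ x in u..v, f x := fun u v =>
    intervalIntegral.integral_interval_sub_left (hint _ _) (hint _ _)
  have hGlip : ∀ u v, dist (G u) (G v) ≤ ‖f‖ * dist u v := by
    intro u v
    rw [Real.dist_eq, Real.dist_eq, hGsub]
    exact intervalIntegral.norm_integral_le_of_norm_le_const fun x _ => f.norm_coe_le_norm x
  have hcomp : AbsolutelyContinuousOnInterval (fun y => G (ψ y)) a b := by
    have h0 := Filter.Tendsto.const_mul ‖f‖ hψ
    rw [mul_zero] at h0
    refine squeeze_zero (fun E => Finset.sum_nonneg fun i _ => dist_nonneg) (fun E => ?_) h0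
    rw [Finset.mul_sum]
    exact Finset.sum_le_sum fun i _ => hGlip _ _
  rw [← hGsub, ← hcomp.integral_deriv_eq_sub]
  refine intervalIntegral.integral_congr_ae ?_
  filter_upwards [hψ.ae_differentiableAt] with y hy hmem
  exact (((hGd (ψ y)).comp y (hy (uIoc_subset_uIcc hmem)).hasDerivAt).deriv).symm

/-- Lebesgue measure on the range of an absolutely continuous function is dominated by the
push-forward of the positive part of its derivative. -/
theorem restrict_Ioc_le_map {ψ : ℝ → ℝ} (hψ : ∀ a b, AbsolutelyContinuousOnInterval ψ a b)
    {a b : ℝ} (hab : a ≤ b) (hψab : ψ a ≤ ψ b) :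
    volume.restrict (Ioc (ψ a) (ψ b)) ≤
      ((volume.restrict (Ioc a b)).withDensity fun y => ENNReal.ofReal (deriv ψ y)).map ψ := by
  have hm : Measurable ψ := (continuous_of_forall hψ).measurable
  have hdm : Measurable (deriv ψ) := measurable_deriv ψ
  have hdi : IntegrableOn (deriv ψ) (Ioc a b) volume :=
    (intervalIntegrable_iff_integrableOn_Ioc_of_le hab).1 (hψ a b).intervalIntegrable_deriv
  have hfin1 := isFiniteMeasure_withDensity_ofReal hdi.hasFiniteIntegral
  have hfin2 := isFiniteMeasure_withDensity_ofReal hdi.neg.hasFiniteIntegral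
  -- Tested against bounded continuous functions, the substitution rule is an identity of signed
  -- measures. Moving the negative part of ψ' to the left turns it into an identity of finite
  -- positive measures.
  have key : volume.restrict (Ioc (ψ a) (ψ b)) +
      ((volume.restrict (Ioc a b)).withDensity fun y => ENNReal.ofReal ((-deriv ψ) y)).map ψ =
      ((volume.restrict (Ioc a b)).withDensity fun y => ENNReal.ofReal (deriv ψ y)).map ψ := by
    refine ext_of_forall_integral_eq_of_IsFiniteMeasure fun f => ?_
    have hfi : ∀ μ : Measure ℝ, IsFiniteMeasure μ → Integrable f μ := fun μ _ => f.integrable μ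
    rw [integral_add_measure (hfi _ inferInstance) (hfi _ inferInstance),
      integral_map hm.aemeasurable f.continuous.aestronglyMeasurable,
      integral_map hm.aemeasurable f.continuous.aestronglyMeasurable,
      integral_withDensity_eq_integral_toReal_smul (hdm.neg.ennreal_ofReal)
        (Filter.Eventually.of_forall fun _ => ENNReal.ofReal_lt_top),
      integral_withDensity_eq_integral_toReal_smul (hdm.ennreal_ofReal)
        (Filter.Eventually.of_forall fun _ => ENNReal.ofReal_lt_top),
      ← intervalIntegral.integral_of_le hψab, ← integral_comp_mul_deriv (hψ a b) f,
      intervalIntegral.integral_of_le hab, ← integral_add]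
    · refine integral_congr_ae (Filter.Eventually.of_forall fun y => ?_)
      simp only [Pi.neg_apply, smul_eq_mul, ENNReal.toReal_ofReal']
      rcases le_total 0 (deriv ψ y) with h | h
      · rw [max_eq_right (by linarith), max_eq_left h]; ring
      · rw [max_eq_left (by linarith), max_eq_right h]; ring
    · exact hdi.bdd_mul (c := ‖f‖)
        (f.continuous.comp (continuous_of_forall hψ)).aestronglyMeasurable
        (Filter.Eventually.of_forall fun y => f.norm_coe_le_norm _)
    · refine Integrable.mul_bdd (c := ‖f‖) ?_
        (f.continuous.comp (continuous_of_forall hψ)).aestronglyMeasurable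
        (Filter.Eventually.of_forall fun y => f.norm_coe_le_norm _)
      simp only [ENNReal.toReal_ofReal']
      exact hdi.neg.pos_part
  rw [← key]
  exact Measure.le_add_right le_rfl

theorem setLIntegral_Ioc_le {ψ : ℝ → ℝ} (hψ : ∀ a b, AbsolutelyContinuousOnInterval ψ a b)
    {a b : ℝ} (hab : a ≤ b) {F : ℝ → ℝ≥0∞} (hF : Measurable F) :
    ∫⁻ x in Ioc (ψ a) (ψ b), F x ≤ ∫⁻ y in Ioc a b, F (ψ y) * ‖deriv ψ y‖ₑ := by
  rcases le_total (ψ a) (ψ b) with h | h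
  · have hm : Measurable ψ := (continuous_of_forall hψ).measurable
    have hdm : Measurable (deriv ψ) := measurable_deriv ψ
    refine (lintegral_mono' (restrict_Ioc_le_map hψ hab h) le_rfl).trans ?_
    rw [lintegral_map hF hm]
    refine (lintegral_withDensity_eq_lintegral_mul _ hdm.ennreal_ofReal (hF.comp hm)).trans_le ?_
    refine lintegral_mono fun y => ?_
    simp only [Pi.mul_apply, Function.comp_apply]
    rw [mul_comm]
    gcongr
    exact Real.ofReal_le_enorm _
  · rw [Ioc_eq_empty (by simpa using h)]
    simp

theorem setLIntegral_Ioc_le' {ψ : ℝ → ℝ} (hψ : ∀ a b, AbsolutelyContinuousOnInterval ψ a b)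
    {a b : ℝ} (hab : a ≤ b) {F : ℝ → ℝ≥0∞} (hF : Measurable F) :
    ∫⁻ x in Ioc (ψ b) (ψ a), F x ≤ ∫⁻ y in Ioc a b, F (ψ y) * ‖deriv ψ y‖ₑ := by
  have h := setLIntegral_Ioc_le (fun a b => (hψ a b).neg) hab (F := fun x => F (-x))
    (hF.comp measurable_neg)
  have h2 : ∫⁻ x in Ioc (-ψ a) (-ψ b), F (-x) = ∫⁻ x in Ioc (ψ b) (ψ a), F x := by
    rw [← setLIntegral_congr (Ico_ae_eq_Ioc (μ := volume) (a := ψ b) (b := ψ a)),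
      ← (Measure.measurePreserving_neg (volume : Measure ℝ)).setLIntegral_comp_preimage
        measurableSet_Ico hF]
    simp
  simpa [h2, deriv.neg, enorm_neg] using h

/-- Only the sign of ψ at the endpoint with the larger modulus matters: there ψ or -ψ agrees with
|ψ|, and the signed interval contains the interval of moduli. Both directions are needed, for the
ascent to a point and the descent from it. -/
theorem setLIntegral_Ioc_abs_le {ψ : ℝ → ℝ} (hψ : ∀ a b, AbsolutelyContinuousOnInterval ψ a b)
    {a b : ℝ} (hab : a ≤ b) {F : ℝ → ℝ≥0∞} (hF : Measurable F) :
    ∫⁻ x in Ioc |ψ a| |ψ b|, F x ≤ ∫⁻ y in Ioc a b, F |ψ y| * ‖deriv ψ y‖ₑ ∧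
    ∫⁻ x in Ioc |ψ b| |ψ a|, F x ≤ ∫⁻ y in Ioc a b, F |ψ y| * ‖deriv ψ y‖ₑ := by
  have habs : Measurable fun x => F |x| := hF.comp continuous_abs.measurable
  have restr : ∀ u v : ℝ, 0 ≤ v →
      ∫⁻ x in Ioc |u| |v|, F x ≤ ∫⁻ x in Ioc u v, F |x| := by
    intro u v hv
    rw [abs_of_nonneg hv]
    refine le_trans (le_of_eq (setLIntegral_congr_fun measurableSet_Ioc fun x hx => ?_))
      (lintegral_mono_set (Ioc_subset_Ioc_left (le_abs_self _)))
    rw [abs_of_pos ((abs_nonneg _).trans_lt hx.1)]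
  have restr' : ∀ u v : ℝ, v ≤ 0 →
      ∫⁻ x in Ioc |u| |v|, F x ≤ ∫⁻ x in Ioc (-u) (-v), F |x| := by
    intro u v hv
    simpa using restr (-u) (-v) (by linarith)
  have hneg := fun a b => (hψ a b).neg
  constructor
  · rcases le_total 0 (ψ b) with hb | hb
    · exact (restr _ _ hb).trans (setLIntegral_Ioc_le hψ hab habs)
    · simpa [deriv.neg, enorm_neg] using (restr' (ψ a) _ hb).trans
        (setLIntegral_Ioc_le hneg hab habs)
  · rcases le_total 0 (ψ a) with hb | hb
    · exact (restr _ _ hb).trans (setLIntegral_Ioc_le' hψ hab habs)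
    · simpa [deriv.neg, enorm_neg] using (restr' (ψ b) _ hb).trans
        (setLIntegral_Ioc_le' hneg hab habs)

end AbsolutelyContinuousOnInterval

/-! ### Weighted variation of a phase field. -/

/-- An integrable function is arbitrarily small somewhere on every set of infinite measure. -/
theorem MeasureTheory.Integrable.exists_mem_abs_lt {ψ : ℝ → ℝ} (hψ : Integrable ψ) {s : Set ℝ}
    (hs : volume s = ∞) {ε : ℝ} (hε : 0 < ε) : ∃ y ∈ s, |ψ y| < ε := by
  by_contra! h
  have h1 : volume {y | ε ≤ ‖ψ y‖} < ∞ := hψ.measure_norm_ge_lt_top hε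
  have h2 : s ⊆ {y | ε ≤ ‖ψ y‖} := fun y hy => h y hy
  exact absurd (hs ▸ measure_mono h2) (not_le.2 h1)

namespace IsPhaseField

variable {ψ : ℝ → ℝ} {w : ℝ}

theorem continuous (h : IsPhaseField ψ w) : Continuous ψ :=
  AbsolutelyContinuousOnInterval.continuous_of_forall h.locallyAbsolutelyContinuous

/-- Monotone convergence as ε → 0. It is needed because ψ may never vanish, but only take
arbitrarily small values far out. -/
theorem setLIntegral_Ioc_zero_le_of_forall {F : ℝ → ℝ≥0∞} {m : ℝ} {R : ℝ≥0∞}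
    (h : ∀ ε > 0, ∫⁻ x in Ioc ε m, F x ≤ R) : ∫⁻ x in Ioc 0 m, F x ≤ R := by
  have hU : Ioc 0 m = ⋃ n : ℕ, Ioc (1 / ((n : ℝ) + 1)) m := by
    ext x
    simp only [mem_Ioc, mem_iUnion]
    constructor
    · rintro ⟨h0, h1⟩
      obtain ⟨n, hn⟩ := exists_nat_one_div_lt h0
      exact ⟨n, hn, h1⟩
    · rintro ⟨n, hn, h1⟩
      exact ⟨lt_trans (by positivity) hn, h1⟩
  rw [hU, setLIntegral_iUnion_of_directed]
  · exact iSup_le fun n => h _ (by positivity)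
  · refine Monotone.directed_le fun n k hnk => Ioc_subset_Ioc_left ?_
    exact one_div_le_one_div_of_le (by positivity) (by gcongr)

/-- The weighted variation of `|ψ|` on each side of a point `y` is at least the weighted length of
`(0, |ψ y|]`. -/
theorem two_mul_setLIntegral_Ioc_le (h : IsPhaseField ψ w) {F : ℝ → ℝ≥0∞} (hF : Measurable F)
    (y : ℝ) : 2 * ∫⁻ x in Ioc 0 |ψ y|, F x ≤ ∫⁻ y, F |ψ y| * ‖deriv ψ y‖ₑ := by
  have hr : ∫⁻ x in Ioc 0 |ψ y|, F x ≤ ∫⁻ y in Ioi y, F |ψ y| * ‖deriv ψ y‖ₑ := by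
    refine setLIntegral_Ioc_zero_le_of_forall fun ε hε => ?_
    obtain ⟨b, hb, hbε⟩ := h.integrable.exists_mem_abs_lt (s := Ioi y) (by simp) hε
    refine (lintegral_mono_set (Ioc_subset_Ioc_left hbε.le)).trans
      (((AbsolutelyContinuousOnInterval.setLIntegral_Ioc_abs_le h.locallyAbsolutelyContinuous
        (le_of_lt hb) hF).2).trans (lintegral_mono_set Ioc_subset_Ioi_self))
  have hl : ∫⁻ x in Ioc 0 |ψ y|, F x ≤ ∫⁻ y in Iic y, F |ψ y| * ‖deriv ψ y‖ₑ := by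
    refine setLIntegral_Ioc_zero_le_of_forall fun ε hε => ?_
    obtain ⟨a, ha, haε⟩ := h.integrable.exists_mem_abs_lt (s := Iic y) (by simp) hε
    refine (lintegral_mono_set (Ioc_subset_Ioc_left haε.le)).trans
      (((AbsolutelyContinuousOnInterval.setLIntegral_Ioc_abs_le h.locallyAbsolutelyContinuous
        ha hF).1).trans (lintegral_mono_set Ioc_subset_Iic_self))
  rw [← lintegral_add_compl (fun y => F |ψ y| * ‖deriv ψ y‖ₑ) (measurableSet_Iic (a := y)), compl_Iic, two_mul]
  exact add_le_add hl hr

/-- The supremum of |ψ| need not be attained or finite, so the one-point bound is passed to the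
limit along the nested intervals (0, |ψ q|]. Rational q suffice by continuity, and F vanishes on
whatever these intervals miss. -/
theorem two_mul_setLIntegral_Ioi_le (h : IsPhaseField ψ w) {F : ℝ → ℝ≥0∞} (hF : Measurable F)
    (hF0 : ∀ x, 0 < x → (∀ y, |ψ y| ≤ x) → F x = 0) :
    2 * ∫⁻ x in Ioi 0, F x ≤ ∫⁻ y, F |ψ y| * ‖deriv ψ y‖ₑ := by
  set U : Set ℝ := ⋃ q : ℚ, Ioc 0 |ψ q| with hU
  have hUm : MeasurableSet U := MeasurableSet.iUnion fun q => measurableSet_Ioc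
  have hUI : ∫⁻ x in U, F x = ∫⁻ x in Ioi 0, F x := by
    rw [← lintegral_indicator hUm, ← lintegral_indicator measurableSet_Ioi]
    refine lintegral_congr fun x => ?_
    by_cases hx : 0 < x
    · rw [indicator_of_mem (s := Ioi 0) (by simpa using hx)]
      by_cases hxU : x ∈ U
      · rw [indicator_of_mem hxU]
      · rw [indicator_of_notMem hxU, hF0 x hx]
        intro y
        have hcl : IsClosed {y | |ψ y| ≤ x} :=
          isClosed_le (continuous_abs.comp h.continuous) continuous_const
        have hdense : DenseRange ((↑) : ℚ → ℝ) := Rat.denseRange_cast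
        refine hdense.induction_on (p := fun y => |ψ y| ≤ x) y hcl fun q => ?_
        by_contra hq
        exact hxU (mem_iUnion.2 ⟨q, hx, (not_le.1 hq).le⟩)
    · rw [indicator_of_notMem (s := Ioi 0) (by simpa using hx), indicator_of_notMem]
      simp only [hU, mem_iUnion, not_exists, mem_Ioc]
      exact fun q hq => hx hq.1
  rw [← hUI, hU, setLIntegral_iUnion_of_directed, ENNReal.mul_iSup]
  · exact iSup_le fun q => h.two_mul_setLIntegral_Ioc_le hF q
  · intro p q
    rcases le_total |ψ p| |ψ q| with hpq | hpq
    · exact ⟨q, Ioc_subset_Ioc_right hpq, subset_rfl⟩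
    · exact ⟨p, subset_rfl, Ioc_subset_Ioc_right hpq⟩

theorem ofReal_le_lintegral_enorm (h : IsPhaseField ψ w) : ENNReal.ofReal w ≤ ∫⁻ y, ‖ψ y‖ₑ := by
  refine (Real.ofReal_le_enorm w).trans ?_
  rw [← h.mass]
  exact enorm_integral_le_lintegral_enorm ψ

end IsPhaseField

/-! ### The lower bound for the energy. -/

/-- The speed `√(2 φ (z(φ) - t)₊)` of an optimal profile with multiplier `t` at level `φ`. -/
noncomputable def profileSpeed (z : ℝ≥0 → ℝ≥0∞) (t : ℝ≥0) (x : ℝ) : ℝ≥0∞ :=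
  (2 * (ENNReal.ofReal x * (z x.toNNReal - t))) ^ (1 / 2 : ℝ)

theorem measurable_profileSpeed {z : ℝ≥0 → ℝ≥0∞} (hz : Measurable z) (t : ℝ≥0) :
    Measurable (profileSpeed z t) := by
  unfold profileSpeed
  have : Measurable fun x : ℝ => z x.toNNReal := hz.comp measurable_real_toNNReal
  fun_prop

/-- Young's inequality with a possibly infinite term. -/
theorem ENNReal.sqrt_two_mul_mul_le (a : ℝ≥0∞) (d : ℝ) :
    (2 * a) ^ (1 / 2 : ℝ) * ‖d‖ₑ ≤ ENNReal.ofReal (1 / 2 * |d| ^ 2) + a := by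
  induction a with
  | top => simp
  | coe a =>
    have h : (2 * (a : ℝ≥0∞)) ^ (1 / 2 : ℝ) = ENNReal.ofReal (Real.sqrt (2 * a)) := by
      rw [Real.sqrt_eq_rpow, ← ENNReal.ofReal_rpow_of_nonneg (by positivity) (by positivity),
        ENNReal.ofReal_mul (by norm_num)]
      simp
    rw [h, ← ofReal_norm, ← ENNReal.ofReal_mul (by positivity), ← ENNReal.ofReal_coe_nnreal,
      ← ENNReal.ofReal_add (by positivity) (by positivity), Real.norm_eq_abs]
    refine ENNReal.ofReal_le_ofReal ?_
    have := Real.sq_sqrt (show (0 : ℝ) ≤ 2 * a by positivity)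
    nlinarith [sq_nonneg (Real.sqrt (2 * a) - |d|)]

/-- Lower bound for the phase field energy by means of the multiplier `t = infᵧ z(|ψ(y)|)`. -/
theorem IsPhaseField.exists_le_phaseFieldEnergy {ψ : ℝ → ℝ} {w : ℝ≥0} (h : IsPhaseField ψ w)
    {z : ℝ≥0 → ℝ≥0∞} (hz : Antitone z)
    (hE : phaseFieldEnergy (phaseFieldCost z) ψ ≠ ∞) (hw : w ≠ 0) :
    ∃ t : ℝ≥0, 2 * (∫⁻ x in Ioi 0, profileSpeed z t x) + t * w ≤
      phaseFieldEnergy (phaseFieldCost z) ψ := by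
  have hzm : Measurable z := hz.measurable
  have hψm : Measurable ψ := h.continuous.measurable
  -- Since w ≠ 0, ψ is nonzero on a nonempty open set; an infinite infimum would make the energy
  -- density infinite there.
  have ht : (⨅ y, z ‖ψ y‖₊) ≠ ∞ := by
    intro htop
    rw [iInf_eq_top] at htop
    obtain ⟨y, hy⟩ : ∃ y, ψ y ≠ 0 := by
      by_contra! h0
      have : ψ = fun _ => 0 := funext h0
      have hm := h.mass
      rw [this] at hm
      simp only [integral_zero] at hm
      exact hw (by exact_mod_cast hm.symm)
    have hopen : IsOpen {y | ψ y ≠ 0} := isOpen_ne_fun h.continuous continuous_const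
    refine hE (top_unique ?_)
    calc ∞ = ∫⁻ y in {y | ψ y ≠ 0}, ∞ := by
          rw [setLIntegral_const, ENNReal.top_mul (hopen.measure_pos volume ⟨y, hy⟩).ne']
      _ ≤ ∫⁻ y in {y | ψ y ≠ 0}, (ENNReal.ofReal ((1 / 2) * |deriv ψ y| ^ 2)
            + phaseFieldCost z ‖ψ y‖₊) := by
          refine setLIntegral_mono' hopen.measurableSet fun x hx => ?_
          simp only [mem_ofPred_eq] at hx
          rw [phaseFieldCost, htop x, ENNReal.mul_top (by simpa using hx)]
          simp
      _ ≤ _ := setLIntegral_le_lintegral _ _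
  obtain ⟨t, htt⟩ : ∃ t : ℝ≥0, (t : ℝ≥0∞) = ⨅ y, z ‖ψ y‖₊ := WithTop.ne_top_iff_exists.1 ht
  refine ⟨t, ?_⟩
  have hle : ∀ y, (t : ℝ≥0∞) ≤ z ‖ψ y‖₊ := fun y => htt.trans_le (iInf_le _ y)
  have habs : ∀ y, |ψ y|.toNNReal = ‖ψ y‖₊ := fun y => by
    rw [← Real.norm_eq_abs, norm_toNNReal]
  have hpt : ∀ y, profileSpeed z t |ψ y| * ‖deriv ψ y‖ₑ + t * ‖ψ y‖ₑ ≤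
      ENNReal.ofReal ((1 / 2) * |deriv ψ y| ^ 2) + phaseFieldCost z ‖ψ y‖₊ := by
    intro y
    have h1 : phaseFieldCost z ‖ψ y‖₊ =
        ENNReal.ofReal |ψ y| * (z ‖ψ y‖₊ - t) + t * ‖ψ y‖ₑ := by
      rw [← Real.norm_eq_abs, ofReal_norm, mul_comm (t : ℝ≥0∞), ← mul_add,
        tsub_add_cancel_of_le (hle y)]
      rfl
    rw [h1, ← add_assoc]
    gcongr
    rw [profileSpeed, habs]
    exact ENNReal.sqrt_two_mul_mul_le _ _
  -- Above the range of |ψ| monotonicity gives z(x) ≤ inf z(|ψ|) = t, so the truncated difference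
  -- z(x) - t is zero. This is why t is chosen as the infimum.
  have hFz : ∀ x, 0 < x → (∀ y, |ψ y| ≤ x) → profileSpeed z t x = 0 := by
    intro x hx hxy
    have : z x.toNNReal ≤ t := by
      rw [htt]
      refine le_iInf fun y => hz ?_
      rw [← habs]
      exact Real.toNNReal_le_toNNReal (hxy y)
    simp [profileSpeed, tsub_eq_zero_of_le this]
  calc 2 * (∫⁻ x in Ioi 0, profileSpeed z t x) + t * w
      ≤ (∫⁻ y, profileSpeed z t |ψ y| * ‖deriv ψ y‖ₑ) + t * ∫⁻ y, ‖ψ y‖ₑ := by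
        gcongr
        · exact h.two_mul_setLIntegral_Ioi_le (measurable_profileSpeed hzm t) hFz
        · simpa using h.ofReal_le_lintegral_enorm
    _ = ∫⁻ y, (profileSpeed z t |ψ y| * ‖deriv ψ y‖ₑ + t * ‖ψ y‖ₑ) := by
        rw [lintegral_add_right _ (by fun_prop), lintegral_const_mul _ (by fun_prop)]
    _ ≤ _ := lintegral_mono hpt

/-! ### Decreasing rearrangement. -/

/-- The decreasing rearrangement of the identity with respect to a measure on `(0,∞)`. -/
noncomputable def decreasingRearrangement (μ : Measure ℝ) (y : ℝ) : ℝ :=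
  sSup {a : ℝ | a = 0 ∨ (0 ≤ a ∧ ENNReal.ofReal y < μ (Ioi a))}

namespace decreasingRearrangement

variable {μ : Measure ℝ} {Φ : ℝ}

theorem mem_le (hΦ : 0 ≤ Φ) (hμ : μ (Ioi Φ) = 0) (y : ℝ) {a : ℝ}
    (ha : a = 0 ∨ (0 ≤ a ∧ ENNReal.ofReal y < μ (Ioi a))) : a ≤ Φ := by
  rcases ha with rfl | ⟨_, h⟩
  · exact hΦ
  · by_contra! hlt
    rw [measure_mono_null (Ioi_subset_Ioi hlt.le) hμ] at h
    exact not_lt_zero h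

theorem bddAbove (hΦ : 0 ≤ Φ) (hμ : μ (Ioi Φ) = 0) (y : ℝ) :
    BddAbove {a : ℝ | a = 0 ∨ (0 ≤ a ∧ ENNReal.ofReal y < μ (Ioi a))} :=
  ⟨Φ, fun _ ha => mem_le hΦ hμ y ha⟩

theorem nonneg (hΦ : 0 ≤ Φ) (hμ : μ (Ioi Φ) = 0) (y : ℝ) : 0 ≤ decreasingRearrangement μ y :=
  le_csSup (bddAbove hΦ hμ y) (Or.inl rfl)

theorem le (hΦ : 0 ≤ Φ) (hμ : μ (Ioi Φ) = 0) (y : ℝ) : decreasingRearrangement μ y ≤ Φ :=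
  csSup_le ⟨0, Or.inl rfl⟩ fun _ ha => mem_le hΦ hμ y ha

/-- The equivalence with strict inequalities rests on right continuity of a ↦ μ(Ioi a), that is, on
continuity of μ from below along Ioi (a + 1/(n+1)). -/
theorem lt_iff (hΦ : 0 ≤ Φ) (hμ : μ (Ioi Φ) = 0) (y : ℝ) {a : ℝ} (ha : 0 ≤ a) :
    a < decreasingRearrangement μ y ↔ ENNReal.ofReal y < μ (Ioi a) := by
  constructor
  · intro h
    obtain ⟨b, hb, hab⟩ := exists_lt_of_lt_csSup (s := {a : ℝ | a = 0 ∨ (0 ≤ a ∧ ENNReal.ofReal y < μ (Ioi a))})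
      ⟨0, Or.inl rfl⟩ h
    rcases hb with rfl | ⟨_, hb⟩
    · exact absurd ha (not_le.2 hab)
    · exact hb.trans_le (measure_mono (Ioi_subset_Ioi hab.le))
  · intro h
    have hU : Ioi a = ⋃ n : ℕ, Ioi (a + 1 / ((n : ℝ) + 1)) := by
      ext x
      simp only [mem_Ioi, mem_iUnion]
      constructor
      · intro hx
        obtain ⟨n, hn⟩ := exists_nat_one_div_lt (sub_pos.2 hx)
        exact ⟨n, by linarith⟩
      · rintro ⟨n, hn⟩
        have : (0 : ℝ) < 1 / ((n : ℝ) + 1) := by positivity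
        linarith
    rw [hU, Directed.measure_iUnion, lt_iSup_iff] at h
    · obtain ⟨n, hn⟩ := h
      have hpos : (0 : ℝ) < 1 / ((n : ℝ) + 1) := by positivity
      refine lt_of_lt_of_le (by linarith)
        (le_csSup (bddAbove hΦ hμ y) (Or.inr ⟨by positivity, hn⟩))
    · refine Monotone.directed_le fun n k hnk => Ioi_subset_Ioi ?_
      have := one_div_le_one_div_of_le (show (0 : ℝ) < (n : ℝ) + 1 by positivity)
        (show (n : ℝ) + 1 ≤ k + 1 by gcongr)
      linarith

theorem antitone (hΦ : 0 ≤ Φ) (hμ : μ (Ioi Φ) = 0) : Antitone (decreasingRearrangement μ) := by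
  intro y y' hyy
  refine csSup_le_csSup (bddAbove hΦ hμ y) ⟨0, Or.inl rfl⟩ ?_
  rintro a (rfl | ⟨h0, h⟩)
  · exact Or.inl rfl
  · exact Or.inr ⟨h0, (ENNReal.ofReal_le_ofReal hyy).trans_lt h⟩

theorem volume_Ioi_inter {m : ℝ≥0∞} :
    volume ({y : ℝ | ENNReal.ofReal y < m} ∩ Ioi 0) = m := by
  induction m with
  | top =>
    have : {y : ℝ | ENNReal.ofReal y < ⊤} ∩ Ioi 0 = Ioi 0 := by
      ext y; simp
    rw [this]; simp
  | coe m =>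
    have : {y : ℝ | ENNReal.ofReal y < m} ∩ Ioi 0 = Ioo 0 (m : ℝ) := by
      ext y
      simp only [mem_inter_iff, mem_ofPred_eq, mem_Ioi, mem_Ioo]
      rw [and_comm]
      refine and_congr_right fun hy => ?_
      rw [← ENNReal.ofReal_coe_nnreal, ENNReal.ofReal_lt_ofReal_iff_of_nonneg hy.le]
    rw [this]; simp

/-- Both measures agree on the half-lines Ioi a with a ≥ 0, which determine them by the π-system
argument wherever they are finite. Hence the exhaustion by Ioi (1/(n+1)): near 0 the measure may be
infinite. -/
theorem map_restrict_Ioi (hΦ : 0 ≤ Φ) (hμ : μ (Ioi Φ) = 0)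
    (hfin : ∀ a > 0, μ (Ioi a) ≠ ∞) :
    ((volume.restrict (Ioi 0)).map (decreasingRearrangement μ)).restrict (Ioi 0) =
      μ.restrict (Ioi 0) := by
  have hm := (antitone hΦ hμ).measurable
  have hIoi : ∀ a, 0 ≤ a → (volume.restrict (Ioi 0)).map (decreasingRearrangement μ) (Ioi a)
      = μ (Ioi a) := by
    intro a ha
    rw [Measure.map_apply hm measurableSet_Ioi,
      Measure.restrict_apply (hm measurableSet_Ioi)]
    have : decreasingRearrangement μ ⁻¹' Ioi a = {y : ℝ | ENNReal.ofReal y < μ (Ioi a)} := by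
      ext y
      exact lt_iff hΦ hμ y ha
    rw [this, volume_Ioi_inter]
  have hU : Ioi (0 : ℝ) = ⋃ n : ℕ, Ioi (1 / ((n : ℝ) + 1)) := by
    ext x
    simp only [mem_Ioi, mem_iUnion]
    constructor
    · intro hx
      exact exists_nat_one_div_lt hx
    · rintro ⟨n, hn⟩
      exact lt_trans (by positivity) hn
  have key : ∀ n : ℕ, ((volume.restrict (Ioi 0)).map (decreasingRearrangement μ)).restrict
      (Ioi (1 / ((n : ℝ) + 1))) = μ.restrict (Ioi (1 / ((n : ℝ) + 1))) := by
    intro n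
    have hpos : (0 : ℝ) < 1 / ((n : ℝ) + 1) := by positivity
    have : IsFiniteMeasure (μ.restrict (Ioi (1 / ((n : ℝ) + 1)))) :=
      ⟨by rw [Measure.restrict_apply_univ]; exact (hfin _ hpos).lt_top⟩
    symm
    refine ext_of_generate_finite _ (borel_eq_generateFrom_Ioi ℝ ▸ BorelSpace.measurable_eq)
      isPiSystem_Ioi ?_ ?_
    · rintro _ ⟨a, rfl⟩
      rw [Measure.restrict_apply measurableSet_Ioi, Measure.restrict_apply measurableSet_Ioi,
        Ioi_inter_Ioi, hIoi _ (le_sup_of_le_right hpos.le)]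
    · rw [Measure.restrict_apply_univ, Measure.restrict_apply_univ, hIoi _ hpos.le]
  have := Measure.restrict_iUnion_congr.2 key
  rwa [← hU] at this

/-- The condition h 0 = 0 discards the set where the rearrangement vanishes, which may have infinite
length. -/
theorem lintegral_comp (hΦ : 0 ≤ Φ) (hμ : μ (Ioi Φ) = 0) (hfin : ∀ a > 0, μ (Ioi a) ≠ ∞)
    {h : ℝ → ℝ≥0∞} (hh : Measurable h) (h0 : h 0 = 0) :
    ∫⁻ y in Ioi 0, h (decreasingRearrangement μ y) = ∫⁻ x in Ioi 0, h x ∂μ := by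
  have hm := (antitone hΦ hμ).measurable
  rw [← map_restrict_Ioi hΦ hμ hfin, ← lintegral_indicator (f := h) measurableSet_Ioi,
    lintegral_map (hh.indicator measurableSet_Ioi) hm]
  refine lintegral_congr fun y => ?_
  by_cases hy : 0 < decreasingRearrangement μ y
  · rw [indicator_of_mem (by exact hy)]
  · have : decreasingRearrangement μ y = 0 := le_antisymm (not_lt.1 hy) (nonneg hΦ hμ y)
    rw [this, h0]
    simp

end decreasingRearrangement

/-! ### Profiles with prescribed speed. -/

theorem lintegral_comp_abs_eq {h : ℝ → ℝ≥0∞} (hh : Measurable h) :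
    ∫⁻ y, h |y| = 2 * ∫⁻ y in Ioi 0, h y := by
  have h1 : ∫⁻ y in Ioi 0, h |y| = ∫⁻ y in Ioi 0, h y :=
    setLIntegral_congr_fun measurableSet_Ioi fun y hy => by rw [abs_of_pos hy]
  have h2 : ∫⁻ y in Iic 0, h |y| = ∫⁻ y in Ioi 0, h y := by
    rw [← h1, ← setLIntegral_congr (Ioi_ae_eq_Ici (μ := volume) (a := (0 : ℝ))).symm,
      ← (Measure.measurePreserving_neg (volume : Measure ℝ)).setLIntegral_comp_preimage
        measurableSet_Ici (show Measurable fun y => h |y| from hh.comp continuous_abs.measurable)]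
    simp
  rw [← lintegral_add_compl (fun y => h |y|) (measurableSet_Iic (a := (0 : ℝ))), compl_Iic, h1, h2,
    two_mul]

/-- The profile travelling down from height `Φ` with prescribed speed `v`, after a plateau of
half-length `L`. -/
theorem exists_isPhaseField_of_speed {Φ L : ℝ} (hΦ : 0 < Φ) (hL : 0 ≤ L) {v : ℝ → ℝ}
    (hvm : Measurable v) (hvpos : ∀ x ∈ Ioo 0 Φ, 0 < v x) (hv0 : ∀ x, x ∉ Ioo 0 Φ → v x = 0)
    (hmass : ∫⁻ x in Ioo 0 Φ, ENNReal.ofReal (x / v x) ≠ ∞) :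
    ∃ ψ : ℝ → ℝ,
      IsPhaseField ψ (2 * (∫⁻ x in Ioo 0 Φ, ENNReal.ofReal (x / v x)).toReal + 2 * L * Φ) ∧
      ∀ c : ℝ≥0 → ℝ≥0∞, Measurable c → c 0 = 0 → phaseFieldEnergy c ψ =
        2 * (∫⁻ x in Ioo 0 Φ, (ENNReal.ofReal (v x / 2) +
          c x.toNNReal * ENNReal.ofReal (v x)⁻¹)) + 2 * ENNReal.ofReal L * c Φ.toNNReal := by
  -- This is the occupation measure of the descending half of the profile: time dx/v(x) at height x,
  -- plus time L at height Φ. Its rearrangement inverts the travel time x ↦ μ(Ioi x), so v need only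
  -- be measurable.
  set μ : Measure ℝ := (volume.restrict (Ioo 0 Φ)).withDensity
    (fun x => ENNReal.ofReal (v x)⁻¹) + ENNReal.ofReal L • Measure.dirac Φ with hμdef
  have hvm' : Measurable fun x => ENNReal.ofReal (v x)⁻¹ := hvm.inv.ennreal_ofReal
  have hint : ∀ (s : Set ℝ) (h : ℝ → ℝ≥0∞), MeasurableSet s → Measurable h →
      ∫⁻ x in s, h x ∂μ = (∫⁻ x in s ∩ Ioo 0 Φ, h x * ENNReal.ofReal (v x)⁻¹) +
        ENNReal.ofReal L * s.indicator h Φ := by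
    intro s h hs hh
    rw [← lintegral_indicator hs, hμdef, lintegral_add_measure, lintegral_smul_measure,
      lintegral_dirac' _ (hh.indicator hs), smul_eq_mul]
    congr 1
    refine (lintegral_withDensity_eq_lintegral_mul _ hvm' (hh.indicator hs)).trans ?_
    rw [← Measure.restrict_restrict hs, ← lintegral_indicator hs]
    refine lintegral_congr fun x => ?_
    by_cases hx : x ∈ s <;> simp [hx, mul_comm]
  have hμΦ : μ (Ioi Φ) = 0 := by
    rw [← setLIntegral_one, hint _ _ measurableSet_Ioi measurable_const]
    have : Ioi Φ ∩ Ioo 0 Φ = ∅ := by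
      ext x; simp only [mem_inter_iff, mem_Ioi, mem_Ioo, mem_empty_iff_false, iff_false]; grind
    simp [this]
  -- For x > a one has 1/v(x) ≤ a⁻¹ · x/v(x), which is integrable by the mass hypothesis.
  have hfin : ∀ a > 0, μ (Ioi a) ≠ ∞ := by
    intro a ha
    rw [← setLIntegral_one, hint _ _ measurableSet_Ioi measurable_const]
    refine ENNReal.add_ne_top.2 ⟨?_, ?_⟩
    · refine ne_top_of_le_ne_top (ENNReal.mul_ne_top (ENNReal.ofReal_ne_top (r := a⁻¹)) hmass) ?_
      rw [← lintegral_const_mul _ (by fun_prop)]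
      refine (setLIntegral_mono' (measurableSet_Ioi.inter measurableSet_Ioo) fun x hx => ?_).trans
        (lintegral_mono_set inter_subset_right)
      rw [one_mul, ← ENNReal.ofReal_mul (by positivity)]
      refine ENNReal.ofReal_le_ofReal ?_
      have hvx := hvpos x hx.2
      have hax : a < x := hx.1
      rw [div_eq_mul_inv, ← mul_assoc]
      refine le_mul_of_one_le_left (by positivity) ?_
      rw [inv_mul_eq_div, one_le_div ha]
      exact hax.le
    · refine ENNReal.mul_ne_top ENNReal.ofReal_ne_top ?_
      simp only [indicator_apply]
      split_ifs <;> simp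
  set ρ := decreasingRearrangement μ with hρ
  have hρanti : Antitone ρ := decreasingRearrangement.antitone hΦ.le hμΦ
  have hρm : Measurable ρ := hρanti.measurable
  have hρ0 : ∀ y, 0 ≤ ρ y := decreasingRearrangement.nonneg hΦ.le hμΦ
  have hρΦ : ∀ y, ρ y ≤ Φ := decreasingRearrangement.le hΦ.le hμΦ
  have hcomp : ∀ h : ℝ → ℝ≥0∞, Measurable h → h 0 = 0 → ∫⁻ y in Ioi 0, h (ρ y) =
      (∫⁻ x in Ioo 0 Φ, h x * ENNReal.ofReal (v x)⁻¹) + ENNReal.ofReal L * h Φ := by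
    intro h hh h0
    rw [decreasingRearrangement.lintegral_comp hΦ.le hμΦ hfin hh h0, hint _ _ measurableSet_Ioi hh,
      inter_eq_right.2 (fun x hx => hx.1), indicator_of_mem (by exact hΦ)]
  have hv00 : v 0 = 0 := hv0 0 (by simp)
  have hvΦ : v Φ = 0 := hv0 Φ (by simp)
  have hvnn : ∀ x, 0 ≤ v x := fun x => by
    by_cases hx : x ∈ Ioo 0 Φ
    · exact (hvpos x hx).le
    · exact (hv0 x hx).ge
  -- This is the integrated form of ρ' = -v(ρ) with ρ → 0 at infinity.
  have htail : ∀ y, 0 ≤ y → ∫⁻ s in Ioi y, ENNReal.ofReal (v (ρ s)) = ENNReal.ofReal (ρ y) := by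
    intro y hy
    have hVm : Measurable fun x => ENNReal.ofReal (v x) := hvm.ennreal_ofReal
    -- The measure has no atoms inside (0, Φ), so ρ has null level sets there. Hence {s > y} can be
    -- replaced by {ρ s < ρ y}: what is lost is null or carries v(ρ s) = 0.
    have hae : ∀ᵐ s ∂volume.restrict (Ioi (0 : ℝ)), v (ρ y) = 0 ∨ ρ s ≠ ρ y := by
      by_cases hvy : v (ρ y) = 0
      · exact Filter.Eventually.of_forall fun s => Or.inl hvy
      have hmem : ρ y ∈ Ioo 0 Φ := by
        by_contra h
        exact hvy (hv0 _ h)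
      have h1 := hcomp (indicator {ρ y} 1) (measurable_one.indicator (measurableSet_singleton _))
        (indicator_of_notMem (by simpa using hmem.1.ne) _)
      rw [indicator_of_notMem (a := Φ) (by simpa using hmem.2.ne'), mul_zero, add_zero] at h1
      have h2 : ∫⁻ x in Ioo 0 Φ, indicator {ρ y} 1 x * ENNReal.ofReal (v x)⁻¹ = 0 := by
        rw [lintegral_eq_zero_iff
          (by exact (measurable_one.indicator (measurableSet_singleton _)).mul hvm')]
        refine ae_restrict_of_ae ?_
        filter_upwards [Measure.ae_ne volume (ρ y)] with x hx
        simp [hx]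
      rw [h2, lintegral_eq_zero_iff
        (by exact (measurable_one.indicator (measurableSet_singleton _)).comp hρm)] at h1
      filter_upwards [h1] with s hs
      refine Or.inr fun h => ?_
      simp [h] at hs
    have h1 : ∫⁻ s in Ioi y, ENNReal.ofReal (v (ρ s)) =
        ∫⁻ s in Ioi 0, (Iio (ρ y)).indicator (fun x => ENNReal.ofReal (v x)) (ρ s) := by
      rw [← inter_eq_left.2 (Ioi_subset_Ioi hy), ← Measure.restrict_restrict measurableSet_Ioi,
        ← lintegral_indicator measurableSet_Ioi]
      refine lintegral_congr_ae ?_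
      filter_upwards [hae] with s hs
      by_cases hsy : y < s
      · rw [indicator_of_mem (by exact hsy)]
        rcases (hρanti hsy.le).lt_or_eq with h | h
        · rw [indicator_of_mem (by exact h)]
        · rw [indicator_of_notMem (by simp [h])]
          rcases hs with hs | hs
          · rw [h, hs, ENNReal.ofReal_zero]
          · exact absurd h hs
      · rw [indicator_of_notMem (by exact hsy), indicator_of_notMem]
        simpa using hρanti (not_lt.1 hsy)
    rw [h1, hcomp _ (hVm.indicator measurableSet_Iio) (by simp [indicator_apply, hv00])]
    have h2 : (Iio (ρ y)).indicator (fun x => ENNReal.ofReal (v x)) Φ = 0 := by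
      simp [indicator_apply, hvΦ]
    have h3 : ∫⁻ x in Ioo 0 Φ, (Iio (ρ y)).indicator (fun x => ENNReal.ofReal (v x)) x *
        ENNReal.ofReal (v x)⁻¹ = ∫⁻ x in Ioo 0 Φ, (Iio (ρ y)).indicator 1 x := by
      refine setLIntegral_congr_fun measurableSet_Ioo fun x hx => ?_
      have hvx := hvpos x hx
      simp only [indicator_apply]
      split_ifs
      · rw [← ENNReal.ofReal_mul hvx.le, mul_inv_cancel₀ hvx.ne']
        simp
      · simp
    rw [h2, h3, lintegral_indicator_one measurableSet_Iio,
      Measure.restrict_apply measurableSet_Iio, mul_zero, add_zero]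
    have h4 : Iio (ρ y) ∩ Ioo 0 Φ = Ioo 0 (ρ y) := by
      ext x
      simp only [mem_inter_iff, mem_Iio, mem_Ioo]
      have := hρΦ y
      grind
    rw [h4, Real.volume_Ioo, sub_zero]
  have hvi : IntegrableOn (fun s => v (ρ s)) (Ioi 0) := by
    refine ⟨(hvm.comp hρm).aestronglyMeasurable, ?_⟩
    rw [hasFiniteIntegral_iff_ofReal (Filter.Eventually.of_forall fun s => hvnn _), htail 0 le_rfl]
    exact ENNReal.ofReal_lt_top
  have htail' : ∀ y, 0 ≤ y → ∫ s in Ioi y, v (ρ s) = ρ y := by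
    intro y hy
    rw [integral_eq_lintegral_of_nonneg_ae (Filter.Eventually.of_forall fun s => hvnn _)
      (hvm.comp hρm).aestronglyMeasurable, htail y hy, ENNReal.toReal_ofReal (hρ0 y)]
  -- The derivative of the even reflection of ρ; its value at 0 is immaterial.
  set u : ℝ → ℝ := fun s => if 0 < s then -v (ρ |s|) else v (ρ |s|) with hu
  have hum : Measurable u := by
    have h1 : Measurable fun s => v (ρ |s|) := hvm.comp (hρm.comp continuous_abs.measurable)
    exact Measurable.ite measurableSet_Ioi h1.neg h1
  have huenorm : ∀ s, ‖u s‖ₑ = ENNReal.ofReal (v (ρ |s|)) := fun s => by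
    rw [Real.enorm_eq_ofReal_abs]
    simp only [hu]
    split_ifs <;> simp [abs_of_nonneg (hvnn _)]
  have hui : Integrable u := by
    refine ⟨hum.aestronglyMeasurable, ?_⟩
    rw [hasFiniteIntegral_iff_enorm]
    simp_rw [huenorm]
    rw [lintegral_comp_abs_eq (h := fun y => ENNReal.ofReal (v (ρ y)))
      (hvm.comp hρm).ennreal_ofReal, htail 0 le_rfl]
    exact ENNReal.mul_lt_top (by simp) ENNReal.ofReal_lt_top
  set ψ : ℝ → ℝ := fun y => ρ |y| with hψ
  have hψpos : ∀ y, 0 ≤ y → ψ y = ρ 0 + ∫ s in (0:ℝ)..y, u s := by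
    intro y hy
    have h1 : ∫ s in (0:ℝ)..y, u s = -∫ s in (0:ℝ)..y, v (ρ s) := by
      rw [← intervalIntegral.integral_neg, intervalIntegral.integral_of_le hy,
        intervalIntegral.integral_of_le hy]
      refine setIntegral_congr_fun measurableSet_Ioc fun s hs => ?_
      simp only [hu]
      rw [if_pos hs.1, abs_of_pos hs.1]
    have h2 : ∫ s in (0:ℝ)..y, v (ρ s) = ρ 0 - ρ y := by
      rw [intervalIntegral.integral_of_le hy, ← htail' 0 le_rfl, ← htail' y hy,
        ← Ioc_union_Ioi_eq_Ioi hy, setIntegral_union (Ioc_disjoint_Ioi le_rfl) measurableSet_Ioi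
          (hvi.mono_set Ioc_subset_Ioi_self) (hvi.mono_set (Ioi_subset_Ioi hy))]
      ring
    rw [h1, h2, hψ]
    simp only [abs_of_nonneg hy]
    ring
  have hueven : ∀ s, s ≠ 0 → u (-s) = -u s := by
    intro s hs
    simp only [hu, abs_neg, Left.neg_pos_iff]
    rcases lt_or_gt_of_ne hs with h | h
    · rw [if_pos h, if_neg (by linarith)]
    · rw [if_neg (by linarith), if_pos h, neg_neg]
  have hψeq : ψ = fun y => ρ 0 + ∫ s in (0:ℝ)..y, u s := by
    funext y
    rcases le_total 0 y with hy | hy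
    · exact hψpos y hy
    · have h1 : ψ y = ψ (-y) := by simp [hψ]
      have h2 : ∫ s in (0:ℝ)..(-y), u s = ∫ s in (0:ℝ)..y, u s := by
        have h3 := intervalIntegral.integral_comp_neg u (a := 0) (b := y)
        have h4 : ∫ s in (0:ℝ)..y, u (-s) = ∫ s in (0:ℝ)..y, -u s := by
          refine intervalIntegral.integral_congr_ae ?_
          filter_upwards [Measure.ae_ne volume 0] with s hs _
          exact hueven s hs
        rw [h4, intervalIntegral.integral_neg, neg_zero] at h3
        rw [intervalIntegral.integral_symm, ← h3, neg_neg]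
      rw [h1, hψpos _ (by linarith), h2]
  have hderiv : ∀ᵐ y, deriv ψ y = u y := by
    filter_upwards [LocallyIntegrable.ae_hasDerivAt_integral hui.locallyIntegrable] with y hy
    rw [hψeq]
    exact ((hy 0).const_add (ρ 0)).deriv
  have hψac : ∀ a b, AbsolutelyContinuousOnInterval ψ a b := by
    intro a b
    have h1 : AbsolutelyContinuousOnInterval (fun y => ∫ s in (0 : ℝ)..y, u s)
        (min (min a b) 0) (max (max a b) 0) :=
      hui.intervalIntegrable.absolutelyContinuousOnInterval_intervalIntegral
        (by simp)
    have h2 := h1.mono (c := a) (d := b) (uIcc_subset_uIcc (by simp) (by simp))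
    rw [hψeq]
    simpa [AbsolutelyContinuousOnInterval] using h2
  have hψm : Measurable ψ := hρm.comp continuous_abs.measurable
  have hψ0 : ∀ y, 0 ≤ ψ y := fun y => hρ0 _
  have hψl : ∫⁻ y, ENNReal.ofReal (ψ y) =
      2 * (∫⁻ x in Ioo 0 Φ, ENNReal.ofReal (x / v x)) + 2 * ENNReal.ofReal L * ENNReal.ofReal Φ := by
    rw [lintegral_comp_abs_eq (h := fun y => ENNReal.ofReal (ρ y)) hρm.ennreal_ofReal,
      hcomp (fun x => ENNReal.ofReal x) (by fun_prop) (by simp), mul_add, mul_assoc]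
    congr 2
    refine setLIntegral_congr_fun measurableSet_Ioo fun x hx => ?_
    rw [← ENNReal.ofReal_mul hx.1.le, div_eq_mul_inv]
  have hψlt : ∫⁻ y, ENNReal.ofReal (ψ y) ≠ ∞ := by
    rw [hψl]
    finiteness
  refine ⟨ψ, ⟨hψac, ⟨hψm.aestronglyMeasurable, ?_⟩, ?_⟩, ?_⟩
  · rw [hasFiniteIntegral_iff_ofReal (Filter.Eventually.of_forall hψ0)]
    exact hψlt.lt_top
  · rw [integral_eq_lintegral_of_nonneg_ae (Filter.Eventually.of_forall hψ0)
      hψm.aestronglyMeasurable, hψl, ENNReal.toReal_add (by finiteness) (by finiteness)]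
    simp [ENNReal.toReal_mul, ENNReal.toReal_ofReal hL, ENNReal.toReal_ofReal hΦ.le]
  · intro c hc hc0
    have h1 : phaseFieldEnergy c ψ = ∫⁻ y, (fun y => ENNReal.ofReal ((1 / 2) * |v (ρ y)| ^ 2)
        + c (ρ y).toNNReal) |y| := by
      refine lintegral_congr_ae ?_
      filter_upwards [hderiv] with y hy
      have h2 : |u y| = |v (ρ |y|)| := by
        simp only [hu]
        split_ifs <;> simp
      have h3 : ‖ψ y‖₊ = (ρ |y|).toNNReal := by
        rw [← norm_toNNReal, Real.norm_of_nonneg (hψ0 y)]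
      simp only [hy, h2, h3]
    have hcm : Measurable fun x : ℝ => c x.toNNReal := hc.comp measurable_real_toNNReal
    have hhm : Measurable fun x : ℝ => ENNReal.ofReal ((1 / 2) * |v x| ^ 2) + c x.toNNReal := by
      have : Measurable fun x => |v x| := continuous_abs.measurable.comp hvm
      fun_prop
    rw [h1, lintegral_comp_abs_eq
      (h := fun y => ENNReal.ofReal ((1 / 2) * |v (ρ y)| ^ 2) + c (ρ y).toNNReal) (hhm.comp hρm), hcomp (fun x => ENNReal.ofReal ((1 / 2) * |v x| ^ 2)
        + c x.toNNReal) hhm (by simp [hv00, hc0]), mul_add, mul_assoc]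
    congr 2
    · refine setLIntegral_congr_fun measurableSet_Ioo fun x hx => ?_
      have hvx := hvpos x hx
      rw [add_mul, ← ENNReal.ofReal_mul (by positivity), abs_of_pos hvx]
      congr 2
      field_simp
    · simp [hvΦ]

/-! ### The generalized inverse and the convolution formula. -/

theorem genInverse_antitone (g : ℝ≥0 → ℝ≥0∞) : Antitone (genInverse g) := by
  intro x x' hxx
  refine le_iInf₂ fun y hy => iInf₂_le y (hy.trans (by exact_mod_cast hxx))

/-- The infimum is attained: by lower semicontinuity g t > x persists slightly to the right of t,
and monotonicity then keeps g > x up to there, so the infimum exceeds t. -/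
theorem genInverse_le_iff {g : ℝ≥0 → ℝ≥0∞} (hlsc : LowerSemicontinuous g) (hanti : Antitone g)
    (x t : ℝ≥0) : genInverse g x ≤ t ↔ g t ≤ x := by
  constructor
  · intro h
    by_contra! hlt
    have hev := hlsc t x hlt
    have h2 : ∀ᶠ s in nhdsWithin t (Ioi t), (x : ℝ≥0∞) < g s := hev.filter_mono nhdsWithin_le_nhds
    obtain ⟨s, hs, hts⟩ := (h2.and self_mem_nhdsWithin).exists
    have hts' : genInverse g x < s := h.trans_lt (by exact_mod_cast hts)
    simp only [genInverse, iInf_lt_iff] at hts'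
    obtain ⟨y, hy, hys⟩ := hts'
    exact absurd ((hanti (by exact_mod_cast hys.le)).trans hy) (not_le.2 hs)
  · exact fun h => iInf₂_le t h

section PowerIntegrals

theorem lintegral_Ioo_rpow {p : ℝ} (hp : -1 < p) {c : ℝ} (hc : 0 ≤ c) :
    ∫⁻ x in Ioo 0 c, ENNReal.ofReal (x ^ p) = ENNReal.ofReal (c ^ (p + 1) / (p + 1)) := by
  have h1 : IntegrableOn (fun x : ℝ => x ^ p) (Ioc 0 c) := by
    rw [← intervalIntegrable_iff_integrableOn_Ioc_of_le hc]
    exact intervalIntegral.intervalIntegrable_rpow' hp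
  have h2 : ∫ x in Ioc 0 c, x ^ p = c ^ (p + 1) / (p + 1) := by
    rw [← intervalIntegral.integral_of_le hc, integral_rpow (Or.inl hp),
      Real.zero_rpow (by linarith), sub_zero]
  rw [setLIntegral_congr Ioo_ae_eq_Ioc, ← h2, ofReal_integral_eq_lintegral_ofReal h1]
  filter_upwards [self_mem_ae_restrict measurableSet_Ioc] with x hx
  exact Real.rpow_nonneg hx.1.le p

theorem lintegral_Ioi_rpow {p : ℝ} (hp : -1 < p) :
    ∫⁻ x in Ioi 0, ENNReal.ofReal (x ^ p) = ∞ := by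
  refine ENNReal.eq_top_of_forall_nnreal_le fun r => ?_
  have hp' : 0 < p + 1 := by linarith
  -- The upper limit is chosen so that the integral equals r.
  have h1 := lintegral_Ioo_rpow hp (c := ((p + 1) * r) ^ (1 / (p + 1))) (by positivity)
  rw [← Real.rpow_mul (by positivity), one_div_mul_cancel hp'.ne', Real.rpow_one,
    mul_div_cancel_left₀ _ hp'.ne', ENNReal.ofReal_coe_nnreal] at h1
  rw [← h1]
  exact lintegral_mono_set Ioo_subset_Ioi_self

/-- Layer cake representation of the square root. -/
theorem lintegral_inv_sqrt_eq (a : ℝ≥0∞) (t : ℝ≥0) :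
    ∫⁻ s in Ioi (t : ℝ), {s : ℝ | ENNReal.ofReal s < a}.indicator
      (fun s => ENNReal.ofReal ((s - t) ^ (-(1 / 2) : ℝ))) s = 2 * (a - t) ^ (1 / 2 : ℝ) := by
  have hshift : ∀ f : ℝ → ℝ≥0∞, ∫⁻ s in Ioi (t : ℝ), f s = ∫⁻ x in Ioi 0, f (x + t) := by
    intro f
    rw [← lintegral_indicator measurableSet_Ioi, ← lintegral_indicator measurableSet_Ioi,
      ← lintegral_add_right_eq_self _ (t : ℝ)]
    refine lintegral_congr fun x => ?_
    simp [indicator_apply]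
  rw [hshift]
  induction a with
  | top =>
    simp only [ENNReal.ofReal_lt_top, ofPred_true, indicator_univ, add_sub_cancel_right]
    rw [lintegral_Ioi_rpow (by norm_num)]
    simp
  | coe a =>
    have h1 : ∀ x ∈ Ioi (0 : ℝ), {s : ℝ | ENNReal.ofReal s < (a : ℝ≥0∞)}.indicator
        (fun s => ENNReal.ofReal ((s - t) ^ (-(1 / 2) : ℝ))) (x + t) =
        (Iio ((a - t : ℝ≥0) : ℝ)).indicator (fun x => ENNReal.ofReal (x ^ (-(1 / 2) : ℝ))) x := by
      intro x hx
      have hx0 : (0 : ℝ) < x := hx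
      have hiff : ENNReal.ofReal (x + t) < (a : ℝ≥0∞) ↔ x < ((a - t : ℝ≥0) : ℝ) := by
        rw [← ENNReal.ofReal_coe_nnreal, ENNReal.ofReal_lt_ofReal_iff_of_nonneg (by positivity),
          NNReal.coe_sub_def, lt_max_iff, lt_sub_iff_add_lt]
        constructor
        · exact Or.inl
        · rintro (h | h)
          · exact h
          · exact absurd h (not_lt.2 hx0.le)
      simp only [indicator_apply, mem_ofPred_eq, mem_Iio, hiff, add_sub_cancel_right]
    rw [setLIntegral_congr_fun measurableSet_Ioi h1, lintegral_indicator measurableSet_Iio,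
      Measure.restrict_restrict measurableSet_Iio, Iio_inter_Ioi,
      lintegral_Ioo_rpow (by norm_num) (by positivity), ← ENNReal.coe_sub,
      ← ENNReal.ofReal_coe_nnreal, ENNReal.ofReal_rpow_of_nonneg (by positivity) (by norm_num)]
    rw [← ENNReal.ofReal_ofNat 2, ← ENNReal.ofReal_mul (by norm_num)]
    congr 1
    norm_num
    ring

/-- The source of the exponent 3/2: the integral of √x over (0, m^{2/3}) is linear in m. -/
theorem lintegral_sqrt_indicator_eq (m : ℝ≥0∞) :
    ∫⁻ x in Ioi (0 : ℝ), {x : ℝ | ((x.toNNReal ^ (3 / 2 : ℝ) : ℝ≥0) : ℝ≥0∞) < m}.indicator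
      (fun x => ENNReal.ofReal (x ^ (1 / 2 : ℝ))) x = ENNReal.ofReal (2 / 3) * m := by
  induction m with
  | top =>
    simp only [ENNReal.coe_lt_top, ofPred_true, indicator_univ]
    rw [lintegral_Ioi_rpow (by norm_num), ENNReal.mul_top (by norm_num)]
  | coe m =>
    have h1 : ∀ x ∈ Ioi (0 : ℝ), {x : ℝ | ((x.toNNReal ^ (3 / 2 : ℝ) : ℝ≥0) : ℝ≥0∞) < m}.indicator
        (fun x => ENNReal.ofReal (x ^ (1 / 2 : ℝ))) x =
        (Iio ((m : ℝ) ^ (2 / 3 : ℝ))).indicator (fun x => ENNReal.ofReal (x ^ (1 / 2 : ℝ))) x := by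
      intro x hx
      have hx0 : (0 : ℝ) < x := hx
      have hiff : ((x.toNNReal ^ (3 / 2 : ℝ) : ℝ≥0) : ℝ≥0∞) < m ↔ x < (m : ℝ) ^ (2 / 3 : ℝ) := by
        rw [ENNReal.coe_lt_coe, ← NNReal.coe_lt_coe, NNReal.coe_rpow, Real.coe_toNNReal _ hx0.le,
          ← Real.rpow_lt_rpow_iff (z := 2 / 3) (by positivity) (by positivity) (by norm_num),
          ← Real.rpow_mul hx0.le]
        norm_num
      simp only [indicator_apply, mem_ofPred_eq, mem_Iio, hiff]
    rw [setLIntegral_congr_fun measurableSet_Ioi h1, lintegral_indicator measurableSet_Iio,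
      Measure.restrict_restrict measurableSet_Iio, Iio_inter_Ioi,
      lintegral_Ioo_rpow (by norm_num) (by positivity), ← Real.rpow_mul (by positivity),
      ← ENNReal.ofReal_coe_nnreal (p := m), ← ENNReal.ofReal_mul (by norm_num)]
    congr 1
    norm_num
    ring

end PowerIntegrals

theorem lconvolution_convKernel_eq (g : ℝ≥0 → ℝ≥0∞) (t : ℝ≥0) :
    lconvolution (extendByZero g) convKernel volume (t : ℝ) =
      ∫⁻ s in Ioi (t : ℝ), g s.toNNReal *
        ENNReal.ofReal (2 * Real.sqrt 2 / 3 * (s - t) ^ (-(1 / 2) : ℝ)) := by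
  rw [lconvolution, ← lintegral_indicator measurableSet_Ioi]
  refine lintegral_congr fun s => ?_
  by_cases hs : (t : ℝ) < s
  · rw [indicator_of_mem (by exact hs), extendByZero, convKernel,
      if_pos (t.coe_nonneg.trans hs.le), if_pos (by linarith)]
    congr 2
    rw [Real.rpow_neg (by linarith), ← Real.sqrt_eq_rpow, neg_add, neg_neg, ← sub_eq_add_neg]
    field_simp
  · rw [indicator_of_notMem (by exact hs), convKernel, if_neg (by linarith), mul_zero]

/-- The mass specific phase field cost constructed from `g`. -/
noncomputable def inverseCost (g : ℝ≥0 → ℝ≥0∞) (φ : ℝ≥0) : ℝ≥0∞ :=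
  genInverse g (φ ^ (3 / 2 : ℝ))

theorem inverseCost_antitone (g : ℝ≥0 → ℝ≥0∞) : Antitone (inverseCost g) := fun _ _ h =>
  genInverse_antitone g (by gcongr)

theorem lt_inverseCost_iff {g : ℝ≥0 → ℝ≥0∞} (hlsc : LowerSemicontinuous g) (hanti : Antitone g)
    (φ t : ℝ≥0) : (t : ℝ≥0∞) < inverseCost g φ ↔ ((φ ^ (3 / 2 : ℝ) : ℝ≥0) : ℝ≥0∞) < g t := by
  rw [← not_le, ← not_le, inverseCost, genInverse_le_iff hlsc hanti]

/-- Write 2√(z(x) - t)₊ as the integral of (s - t)^{-1/2} over t < s < z(x) and exchange the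
integrals. The condition s < z(x) becomes x^{3/2} < g(s), so the integral of √x gives (2/3) g(s).
With the factor √2 from the speed this is the kernel r. -/
theorem two_mul_lintegral_profileSpeed_eq {g : ℝ≥0 → ℝ≥0∞} (hlsc : LowerSemicontinuous g)
    (hanti : Antitone g) (t : ℝ≥0) :
    2 * ∫⁻ x in Ioi 0, profileSpeed (inverseCost g) t x =
      lconvolution (extendByZero g) convKernel volume (t : ℝ) := by
  have hzm : Measurable fun x : ℝ => inverseCost g x.toNNReal :=
    (inverseCost_antitone g).measurable.comp measurable_real_toNNReal
  set K : ℝ → ℝ≥0∞ := fun s => ENNReal.ofReal ((s - t) ^ (-(1 / 2) : ℝ)) with hK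
  have hKm : Measurable K := by fun_prop
  set S : ℝ → ℝ≥0∞ := fun x => ENNReal.ofReal (x ^ (1 / 2 : ℝ)) with hS
  have hSm : Measurable S := by fun_prop
  set D : Set (ℝ × ℝ) := {p | ENNReal.ofReal p.2 < inverseCost g p.1.toNNReal} with hD
  have hDm : MeasurableSet D :=
    measurableSet_lt (measurable_snd.ennreal_ofReal) (hzm.comp measurable_fst)
  set R : ℝ≥0∞ := ENNReal.ofReal (Real.sqrt 2) with hR
  have h1 : ∀ x ∈ Ioi (0 : ℝ), 2 * profileSpeed (inverseCost g) t x =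
      ∫⁻ s in Ioi (t : ℝ), R * D.indicator (fun p => S p.1 * K p.2) (x, s) := by
    intro x hx
    have hx0 : (0 : ℝ) < x := hx
    have h2 : ∀ s, R * D.indicator (fun p => S p.1 * K p.2) (x, s) = R * S x *
        {s : ℝ | ENNReal.ofReal s < inverseCost g x.toNNReal}.indicator K s := by
      intro s
      simp only [indicator_apply, hD, mem_ofPred_eq]
      split_ifs <;> simp [mul_assoc]
    have hSx : S x = ENNReal.ofReal x ^ (1 / 2 : ℝ) :=
      (ENNReal.ofReal_rpow_of_nonneg hx0.le (by norm_num)).symm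
    simp_rw [h2]
    rw [lintegral_const_mul' _ _ (by finiteness), lintegral_inv_sqrt_eq, profileSpeed,
      ← mul_assoc, ENNReal.mul_rpow_of_nonneg _ _ (by norm_num), hR, hSx,
      Real.sqrt_eq_rpow, ← ENNReal.ofReal_rpow_of_nonneg (by norm_num) (by norm_num),
      ENNReal.mul_rpow_of_nonneg _ _ (by norm_num), ENNReal.ofReal_ofNat]
    ring
  rw [← lintegral_const_mul' _ _ (by finiteness), setLIntegral_congr_fun measurableSet_Ioi h1,
    lintegral_lintegral_swap, lconvolution_convKernel_eq]
  · refine setLIntegral_congr_fun measurableSet_Ioi fun s hs => ?_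
    have hs0 : 0 ≤ s := t.coe_nonneg.trans (le_of_lt hs)
    have h3 : ∀ x, R * D.indicator (fun p => S p.1 * K p.2) (x, s) = R * K s *
        {x : ℝ | ((x.toNNReal ^ (3 / 2 : ℝ) : ℝ≥0) : ℝ≥0∞) < g s.toNNReal}.indicator S x := by
      intro x
      have hiff : ENNReal.ofReal s < inverseCost g x.toNNReal ↔
          ((x.toNNReal ^ (3 / 2 : ℝ) : ℝ≥0) : ℝ≥0∞) < g s.toNNReal :=
        lt_inverseCost_iff hlsc hanti _ _
      simp only [indicator_apply, hD, mem_ofPred_eq, hiff]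
      split_ifs <;> simp [mul_assoc, mul_comm (K s)]
    simp_rw [h3]
    rw [lintegral_const_mul' _ _ (by finiteness), lintegral_sqrt_indicator_eq, mul_comm, hR, hK,
      ← ENNReal.ofReal_mul (by positivity), mul_comm (ENNReal.ofReal (2 / 3)), mul_assoc,
      ← ENNReal.ofReal_mul (by positivity)]
    congr 2
    ring
  · exact ((((hSm.comp measurable_fst).mul (hKm.comp measurable_snd)).indicator hDm).const_mul
      R).aemeasurable

/-! ### Supergradients and Fenchel duality. -/

/-- A concave nondecreasing cost has a nonnegative supergradient at every positive mass. -/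
theorem IsAdmissible.exists_supergradient {τ : ℝ≥0 → ℝ≥0} (hτ : IsAdmissible τ) {w : ℝ≥0}
    (hw : 0 < w) : ∃ t : ℝ≥0, ∀ v : ℝ≥0, (τ v : ℝ) ≤ τ w + t * (v - w) := by
  have hconc : ∀ x y z : ℝ≥0, x < y → y < z →
      ((τ z : ℝ) - τ y) / (z - y) ≤ ((τ y : ℝ) - τ x) / (y - x) := by
    intro x y z hxy hyz
    have hxy' : (x : ℝ) < y := hxy
    have hyz' : (y : ℝ) < z := hyz
    have hzx : (0 : ℝ) < z - x := by linarith
    have hzx' : z - x ≠ 0 := (tsub_pos_of_lt (hxy.trans hyz)).ne'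
    have h0 := hτ.concaveOn.2 (mem_univ x) (mem_univ z)
    have h := @h0 ((z - y) / (z - x)) ((y - x) / (z - x)) bot_le bot_le (by
        rw [← NNReal.coe_inj]
        push_cast [NNReal.coe_sub hyz.le, NNReal.coe_sub hxy.le, NNReal.coe_sub (hxy.trans hyz).le]
        field_simp
        ring)
    have harg : ((z - y) / (z - x)) • x + ((y - x) / (z - x)) • z = y := by
      rw [← NNReal.coe_inj]
      push_cast [smul_eq_mul, NNReal.coe_sub hyz.le, NNReal.coe_sub hxy.le,
        NNReal.coe_sub (hxy.trans hyz).le]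
      field_simp
      ring
    rw [harg, ← NNReal.coe_le_coe] at h
    push_cast [smul_eq_mul, NNReal.coe_sub hyz.le, NNReal.coe_sub hxy.le,
      NNReal.coe_sub (hxy.trans hyz).le] at h
    rw [div_le_div_iff₀ (by linarith) (by linarith)]
    rw [div_mul_eq_mul_div, div_mul_eq_mul_div, ← add_div, div_le_iff₀ hzx] at h
    nlinarith
  -- The infimum of the left difference quotients at w serves as t: nonnegative because τ is
  -- nondecreasing, and above every right quotient by concavity.
  set A : Set ℝ := (fun v : ℝ≥0 => ((τ w : ℝ) - τ v) / (w - v)) '' Iio w with hA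
  have hAne : A.Nonempty := ⟨_, 0, hw, rfl⟩
  have hA0 : ∀ a ∈ A, 0 ≤ a := by
    rintro _ ⟨v, hv, rfl⟩
    have hv' : (v : ℝ) < w := hv
    have : (τ v : ℝ) ≤ τ w := hτ.monotone (le_of_lt hv)
    exact div_nonneg (by linarith) (by linarith)
  have ht0 : 0 ≤ sInf A := Real.sInf_nonneg hA0
  refine ⟨⟨sInf A, ht0⟩, fun v => ?_⟩
  change (τ v : ℝ) ≤ τ w + sInf A * (v - w)
  rcases lt_trichotomy v w with h | rfl | h
  · have h1 := csInf_le ⟨0, hA0⟩ (mem_image_of_mem _ (show v ∈ Iio w from h))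
    have hv' : (v : ℝ) < w := h
    rw [le_div_iff₀ (by linarith)] at h1
    linarith
  · simp
  · have hv' : (w : ℝ) < v := h
    have h1 : ((τ v : ℝ) - τ w) / (v - w) ≤ sInf A := by
      refine le_csInf hAne ?_
      rintro _ ⟨u, hu, rfl⟩
      exact hconc u w v hu h
    rw [div_le_iff₀ (by linarith)] at h1
    linarith

theorem fenchelConjugate_extendByBot (τ : ℝ≥0 → ℝ≥0) (t : ℝ) :
    fenchelConjugate (fun s => -extendByBot τ (-s)) t =
      ⨆ v : ℝ≥0, (((τ v : ℝ) - t * v : ℝ) : EReal) := by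
  apply le_antisymm
  · refine iSup_le fun s => ?_
    rcases le_or_gt s 0 with hs | hs
    · refine le_trans (le_of_eq ?_) (le_iSup _ (-s).toNNReal)
      dsimp only
      rw [extendByBot, if_pos (by linarith),
        Real.coe_toNNReal _ (by linarith), ← EReal.coe_neg, ← EReal.coe_sub]
      congr 1
      ring
    · dsimp only
      rw [extendByBot, if_neg (by linarith)]
      simp
  · refine iSup_le fun v => ?_
    refine le_trans (le_of_eq ?_) (le_iSup _ (-(v : ℝ)))
    dsimp only
    rw [neg_neg, extendByBot, if_pos v.coe_nonneg,
      Real.toNNReal_coe, ← EReal.coe_neg, ← EReal.coe_sub]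
    congr 1
    ring

/-- The conjugate dominates all affine gaps (weak duality). -/
theorem SolvesDeconvolution.le_add {τ : ℝ≥0 → ℝ≥0} {g : ℝ≥0 → ℝ≥0∞}
    (h : SolvesDeconvolution τ g) (t v : ℝ≥0) :
    (τ v : ℝ≥0∞) ≤ lconvolution (extendByZero g) convKernel volume (t : ℝ) + t * v := by
  have h1 := h t t.coe_nonneg
  rw [fenchelConjugate_extendByBot] at h1
  have h2 := (le_iSup (fun v : ℝ≥0 => (((τ v : ℝ) - t * v : ℝ) : EReal)) v).trans_eq h1
  generalize lconvolution (extendByZero g) convKernel volume (t : ℝ) = C at h2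
  induction C with
  | top => simp
  | coe C =>
    have h3 : ((τ v : ℝ) - t * v : ℝ) ≤ (C : ℝ) := by
      rwa [EReal.coe_nnreal_eq_coe_real, EReal.coe_le_coe_iff] at h2
    have h4 : τ v ≤ C + t * v := by
      rw [← NNReal.coe_le_coe]
      push_cast
      linarith
    exact_mod_cast h4

/-- No duality gap: at a supergradient t the supremum defining the conjugate is attained at v = w,
and in particular is finite. -/
theorem SolvesDeconvolution.add_le {τ : ℝ≥0 → ℝ≥0} {g : ℝ≥0 → ℝ≥0∞}
    (h : SolvesDeconvolution τ g) {t w : ℝ≥0}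
    (ht : ∀ v : ℝ≥0, (τ v : ℝ) ≤ τ w + t * (v - w)) :
    lconvolution (extendByZero g) convKernel volume (t : ℝ) + t * w ≤ τ w := by
  have h1 := h t t.coe_nonneg
  rw [fenchelConjugate_extendByBot] at h1
  have h2 : (⨆ v : ℝ≥0, (((τ v : ℝ) - t * v : ℝ) : EReal)) ≤ ((τ w : ℝ) - t * w : ℝ) :=
    iSup_le fun v => by
      rw [EReal.coe_le_coe_iff]
      linarith [ht v]
  rw [h1] at h2
  generalize lconvolution (extendByZero g) convKernel volume (t : ℝ) = C at h2
  induction C with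
  | top =>
    rw [EReal.coe_ennreal_top, top_le_iff] at h2
    exact absurd h2 (EReal.coe_ne_top _)
  | coe C =>
    have h3 : (C : ℝ) ≤ ((τ w : ℝ) - t * w : ℝ) := by
      rwa [EReal.coe_nnreal_eq_coe_real, EReal.coe_le_coe_iff] at h2
    have h4 : C + t * w ≤ τ w := by
      rw [← NNReal.coe_le_coe]
      push_cast
      linarith
    exact_mod_cast h4

/-! ### The mass of the optimal profile. -/

/-- Tangent bound for the concave function t ↦ V_t(x), whose derivative is -x/V_t(x). With A =
V_t(x), B = V_s(x) and A² - B² = 2x(s - t) it reduces to (A - B)² ≥ 0. -/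
theorem add_div_le_profileSpeed (z : ℝ≥0 → ℝ≥0∞) {s t : ℝ≥0} (hts : t < s) {x : ℝ} (hx : 0 < x)
    (hsz : (s : ℝ≥0∞) ≤ z x.toNNReal) :
    profileSpeed z s x + (s - t) * (ENNReal.ofReal x / profileSpeed z t x) ≤
      profileSpeed z t x := by
  unfold profileSpeed
  generalize z x.toNNReal = a at hsz
  induction a with
  | top =>
    simp [ENNReal.mul_top, hx]
  | coe a =>
    have hsa : s ≤ a := by exact_mod_cast hsz
    lift x to ℝ≥0 using hx.le
    have hx' : 0 < x := by exact_mod_cast hx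
    have hta : t < a := hts.trans_le hsa
    have hpos : 0 < (2 * (x * (a - t))) ^ (1 / 2 : ℝ) :=
      NNReal.rpow_pos (by have := tsub_pos_of_lt hta; positivity)
    rw [ENNReal.ofReal_coe_nnreal]
    have e1 : ∀ u : ℝ≥0, (2 * ((x : ℝ≥0∞) * ((a : ℝ≥0∞) - u))) ^ (1 / 2 : ℝ) =
        (((2 * (x * (a - u))) ^ (1 / 2 : ℝ) : ℝ≥0) : ℝ≥0∞) := by
      intro u
      rw [ENNReal.coe_rpow_of_nonneg _ (by norm_num : (0 : ℝ) ≤ 1 / 2)]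
      push_cast
      rfl
    rw [e1, e1, ← ENNReal.coe_div hpos.ne']
    norm_cast
    rw [← NNReal.coe_le_coe]
    push_cast [NNReal.coe_sub hsa, NNReal.coe_sub hta.le, NNReal.coe_sub hts.le]
    have hsa' : (s : ℝ) ≤ a := hsa
    have hts' : (t : ℝ) < s := hts
    rw [← Real.sqrt_eq_rpow, ← Real.sqrt_eq_rpow]
    have hA : 0 < Real.sqrt (2 * (x * ((a : ℝ) - t))) :=
      Real.sqrt_pos.2 (by have : (0 : ℝ) < a - t := by linarith
                          positivity)
    have hA2 := Real.sq_sqrt (show (0 : ℝ) ≤ 2 * (x * ((a : ℝ) - t)) by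
      have : (0 : ℝ) < a - t := by linarith
      positivity)
    have hB2 := Real.sq_sqrt (show (0 : ℝ) ≤ 2 * (x * ((a : ℝ) - s)) by
      have : (0 : ℝ) ≤ a - s := by linarith
      positivity)
    rw [← mul_div_assoc, ← le_sub_iff_add_le', div_le_iff₀ hA]
    nlinarith [sq_nonneg (Real.sqrt (2 * (x * ((a : ℝ) - t))) -
      Real.sqrt (2 * (x * ((a : ℝ) - s))))]

theorem profileSpeed_antitone (z : ℝ≥0 → ℝ≥0∞) (x : ℝ) :
    Antitone fun t => profileSpeed z t x := by
  intro s t hst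
  simp only [profileSpeed]
  gcongr

/-- The mass of the optimal profile with multiplier `t` does not exceed any `w` at which `t` is a
supergradient. -/
theorem two_mul_lintegral_div_profileSpeed_le {z : ℝ≥0 → ℝ≥0∞} (hz : Measurable z) {t w : ℝ≥0}
    {M : ℝ≥0} (hle : 2 * (∫⁻ x in Ioi 0, profileSpeed z t x) + t * w ≤ M)
    (hge : ∀ s : ℝ≥0, (M : ℝ≥0∞) ≤ 2 * (∫⁻ x in Ioi 0, profileSpeed z s x) + s * w) :
    2 * ∫⁻ x in Ioi 0 ∩ {x : ℝ | (t : ℝ≥0∞) < z x.toNNReal},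
      ENNReal.ofReal x / profileSpeed z t x ≤ w := by
  have hzr : Measurable fun x : ℝ => z x.toNNReal := hz.comp measurable_real_toNNReal
  have hVm := measurable_profileSpeed hz
  -- Comparing the dual functional at s and t bounds a difference quotient of C. On {z ≥ s} the
  -- tangent bound turns it into mass; these sets exhaust {z > t} as s decreases to t.
  have key : ∀ s : ℝ≥0, t < s → 2 * ∫⁻ x in Ioi 0 ∩ {x : ℝ | (s : ℝ≥0∞) ≤ z x.toNNReal},
      ENNReal.ofReal x / profileSpeed z t x ≤ w := by
    intro s hts
    set E : Set ℝ := {x : ℝ | (s : ℝ≥0∞) ≤ z x.toNNReal} with hE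
    have hEm : MeasurableSet E := measurableSet_le measurable_const hzr
    set J := ∫⁻ x in Ioi 0 ∩ E, ENNReal.ofReal x / profileSpeed z t x with hJ
    have hst0 : (s - t : ℝ≥0) ≠ 0 := (tsub_pos_of_lt hts).ne'
    have h1 : (∫⁻ x in Ioi 0, profileSpeed z s x) + (s - t : ℝ≥0) * J ≤
        ∫⁻ x in Ioi 0, profileSpeed z t x := by
      rw [hJ, inter_comm, ← Measure.restrict_restrict hEm, ← lintegral_indicator hEm,
        ← lintegral_const_mul' _ _ (by finiteness), ← lintegral_add_left (hVm s)]
      refine setLIntegral_mono' measurableSet_Ioi fun x hx => ?_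
      by_cases hxE : x ∈ E
      · rw [indicator_of_mem hxE, ENNReal.coe_sub]
        exact add_div_le_profileSpeed z hts hx hxE
      · rw [indicator_of_notMem hxE, mul_zero, add_zero]
        exact profileSpeed_antitone z x hts.le
    -- Finiteness is what allows the common speed integral to be cancelled in [0,∞].
    have hC : ∀ u : ℝ≥0, t ≤ u → (∫⁻ x in Ioi 0, profileSpeed z u x) ≠ ∞ := by
      intro u htu hu
      have : ∫⁻ x in Ioi 0, profileSpeed z t x = ∞ :=
        top_unique (hu ▸ lintegral_mono fun x => profileSpeed_antitone z x htu)
      rw [this] at hle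
      simp at hle
    have h2 : 2 * (∫⁻ x in Ioi 0, profileSpeed z s x) + ((s - t : ℝ≥0) * (2 * J) + t * w) ≤
        2 * (∫⁻ x in Ioi 0, profileSpeed z s x) + s * w := by
      refine le_trans ?_ (hle.trans (hge s))
      rw [← add_assoc, ← mul_left_comm, ← mul_add]
      gcongr
    have h3 := (ENNReal.add_le_add_iff_left
      (ENNReal.mul_ne_top (by simp) (hC s hts.le))).1 h2
    have h4 : (s : ℝ≥0∞) * w = (s - t : ℝ≥0) * w + t * w := by
      rw [← add_mul, ← ENNReal.coe_add, tsub_add_cancel_of_le hts.le]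
    rw [h4] at h3
    have h5 := (ENNReal.add_le_add_iff_right (by finiteness)).1 h3
    exact (ENNReal.mul_le_mul_iff_right (by exact_mod_cast hst0) (by finiteness)).1 h5
  have hU : Ioi 0 ∩ {x : ℝ | (t : ℝ≥0∞) < z x.toNNReal} =
      ⋃ n : ℕ, Ioi 0 ∩ {x : ℝ | ((t + 1 / ((n : ℝ≥0) + 1) : ℝ≥0) : ℝ≥0∞) ≤ z x.toNNReal} := by
    rw [← inter_iUnion]
    congr 1
    ext x
    simp only [mem_ofPred_eq, mem_iUnion]
    constructor
    · intro h
      obtain ⟨r, htr, hrz⟩ := ENNReal.lt_iff_exists_nnreal_btwn.1 h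
      have htr' : (t : ℝ) < r := by exact_mod_cast htr
      obtain ⟨n, hn⟩ := exists_nat_one_div_lt (sub_pos.2 htr')
      refine ⟨n, le_trans ?_ hrz.le⟩
      rw [ENNReal.coe_le_coe, ← NNReal.coe_le_coe]
      push_cast
      linarith
    · rintro ⟨n, hn⟩
      refine lt_of_lt_of_le ?_ hn
      rw [ENNReal.coe_lt_coe]
      exact lt_add_of_pos_right _ (by positivity)
  rw [hU, setLIntegral_iUnion_of_directed, ENNReal.mul_iSup]
  · exact iSup_le fun n => key _ (lt_add_of_pos_right _ (by positivity))
  · refine Monotone.directed_le fun n k hnk x hx => ⟨hx.1, ?_⟩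
    refine le_trans ?_ (show _ ≤ z x.toNNReal from hx.2)
    rw [ENNReal.coe_le_coe]
    gcongr

/-! ### Upper bounds from explicit profiles. -/

theorem phaseFieldCost_zero (z : ℝ≥0 → ℝ≥0∞) : phaseFieldCost z 0 = 0 := by
  simp [phaseFieldCost]

theorem measurable_phaseFieldCost {z : ℝ≥0 → ℝ≥0∞} (hz : Measurable z) :
    Measurable (phaseFieldCost z) := by
  unfold phaseFieldCost
  fun_prop

theorem inducedCost_zero (z : ℝ≥0 → ℝ≥0∞) : inducedCost (phaseFieldCost z) 0 = 0 := by
  refine le_antisymm ?_ bot_le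
  have h0 : IsPhaseField (fun _ => 0) ((0 : ℝ≥0) : ℝ) :=
    ⟨fun a b => (LipschitzWith.const (0 : ℝ)).lipschitzOnWith.absolutelyContinuousOnInterval,
      integrable_zero _ _ _, by simp⟩
  refine (iInf₂_le (fun _ => 0) h0).trans ?_
  simp [phaseFieldEnergy, phaseFieldCost_zero]

/-- If the mass specific cost never exceeds `t`, long flat profiles cost at most `t` per mass. -/
theorem inducedCost_le_mul {z : ℝ≥0 → ℝ≥0∞} (hz : Measurable z) {t w : ℝ≥0} (hw : 0 < w)
    (hzt : ∀ φ, z φ ≤ t) : inducedCost (phaseFieldCost z) w ≤ t * w := by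
  refine ENNReal.le_of_forall_pos_le_add fun ε hε _ => ?_
  -- The competitor is a trapezoid of height δ with slopes ±1. Its ramps have mass δ² ≤ w and
  -- gradient energy δ ≤ ε; the plateau carries the remaining mass w - δ².
  obtain ⟨δ, hδ0, hδ⟩ : ∃ δ : ℝ, 0 < δ ∧ δ ≤ ε ∧ δ ≤ 1 ∧ δ ≤ w :=
    ⟨min ε (min 1 w), by positivity, min_le_left _ _, (min_le_right _ _).trans (min_le_left _ _),
      (min_le_right _ _).trans (min_le_right _ _)⟩
  have hδw : δ ^ 2 ≤ w := by nlinarith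
  set v : ℝ → ℝ := (Ioo 0 δ).indicator 1 with hv
  have hvm : Measurable v := measurable_one.indicator measurableSet_Ioo
  have hv1 : ∀ x ∈ Ioo 0 δ, v x = 1 := fun x hx => indicator_of_mem hx _
  have hm : ∫⁻ x in Ioo 0 δ, ENNReal.ofReal (x / v x) = ENNReal.ofReal (δ ^ 2 / 2) := by
    have h1 := lintegral_Ioo_rpow (p := 1) (by norm_num) hδ0.le
    rw [setLIntegral_congr_fun (g := fun x => ENNReal.ofReal (x ^ (1 : ℝ))) measurableSet_Ioo
      (fun x hx => by simp only [hv1 x hx, div_one, Real.rpow_one]), h1]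
    norm_num
  obtain ⟨ψ, hψ, hE⟩ := exists_isPhaseField_of_speed (L := (w - δ ^ 2) / (2 * δ)) hδ0
    (div_nonneg (by linarith) (by linarith)) hvm (fun x hx => by rw [hv1 x hx]; norm_num)
    (fun x hx => indicator_of_notMem hx _) (by rw [hm]; finiteness)
  rw [hm, ENNReal.toReal_ofReal (by positivity)] at hψ
  have hmass : 2 * (δ ^ 2 / 2) + 2 * ((w - δ ^ 2) / (2 * δ)) * δ = w := by
    field_simp
    ring
  rw [hmass] at hψ
  refine (iInf₂_le ψ hψ).trans ?_
  rw [hE _ (measurable_phaseFieldCost hz) (phaseFieldCost_zero z)]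
  have hc : ∀ x : ℝ, phaseFieldCost z x.toNNReal ≤ t * ENNReal.ofReal x := fun x => by
    rw [mul_comm]
    exact mul_le_mul_right (hzt _) _
  have h1 : ∫⁻ x in Ioo 0 δ, (ENNReal.ofReal (v x / 2) +
      phaseFieldCost z x.toNNReal * ENNReal.ofReal (v x)⁻¹) ≤
      ENNReal.ofReal (1 / 2) * ENNReal.ofReal δ + t * ENNReal.ofReal (δ ^ 2 / 2) := by
    calc _ ≤ ∫⁻ x in Ioo 0 δ, (ENNReal.ofReal (1 / 2) + t * ENNReal.ofReal (x / v x)) := by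
          refine setLIntegral_mono' measurableSet_Ioo fun x hx => ?_
          rw [hv1 x hx]
          simpa using hc x
      _ = _ := by
          rw [lintegral_add_left measurable_const, setLIntegral_const,
            lintegral_const_mul' _ _ (by finiteness), hm, Real.volume_Ioo, sub_zero]
  have h2 := hc δ
  have hLn : 0 ≤ (w - δ ^ 2) / (2 * δ) := div_nonneg (by linarith) (by linarith)
  calc _ ≤ 2 * (ENNReal.ofReal (1 / 2) * ENNReal.ofReal δ + t * ENNReal.ofReal (δ ^ 2 / 2)) +
        2 * ENNReal.ofReal ((w - δ ^ 2) / (2 * δ)) * (t * ENNReal.ofReal δ) := by gcongr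
    _ = ENNReal.ofReal (t * w + δ) := by
        rw [← ENNReal.ofReal_ofNat 2, ← ENNReal.ofReal_coe_nnreal (p := t),
          ← ENNReal.ofReal_mul (by positivity), ← ENNReal.ofReal_mul (by positivity),
          ← ENNReal.ofReal_add (by positivity) (by positivity),
          ← ENNReal.ofReal_mul (by positivity), ← ENNReal.ofReal_mul (by positivity),
          ← ENNReal.ofReal_mul (by positivity), ← ENNReal.ofReal_mul (by positivity),
          ← ENNReal.ofReal_add (by positivity) (by positivity)]
        congr 1
        field_simp
        ring
    _ ≤ ENNReal.ofReal (t * w + ε) := ENNReal.ofReal_le_ofReal (by linarith [hδ.1])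
    _ = t * w + ε := by
        rw [ENNReal.ofReal_add (by positivity) (by positivity),
          ENNReal.ofReal_mul (by positivity)]
        simp

/-- The optimal profile with multiplier `t`, extended by a plateau at its maximal height `Φ`. -/
theorem inducedCost_le_of_profileSpeed {z : ℝ≥0 → ℝ≥0∞} (hz : Measurable z) {t w : ℝ≥0} {Φ : ℝ}
    (hΦ : 0 < Φ) (hzfin : ∀ x, 0 < x → z x ≠ ∞) (hzΦ : z Φ.toNNReal ≤ t)
    (hzlt : ∀ x, 0 < x → x < Φ → (t : ℝ≥0∞) < z x.toNNReal)
    (hmass : 2 * ∫⁻ x in Ioo 0 Φ, ENNReal.ofReal x / profileSpeed z t x ≤ w) :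
    inducedCost (phaseFieldCost z) w ≤ 2 * (∫⁻ x in Ioi 0, profileSpeed z t x) + t * w := by
  have hVm := measurable_profileSpeed hz t
  have hsub : ∀ x ∈ Ioo 0 Φ, z x.toNNReal - t ≠ 0 ∧ z x.toNNReal - t ≠ ∞ := fun x hx =>
    ⟨(tsub_pos_of_lt (hzlt x hx.1 hx.2)).ne',
      ENNReal.sub_ne_top (hzfin _ (Real.toNNReal_pos.2 hx.1))⟩
  have hV0 : ∀ x ∈ Ioo 0 Φ, profileSpeed z t x ≠ 0 := fun x hx => by
    have := (hsub x hx).1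
    have h0 : 0 < x := hx.1
    simp [profileSpeed, ENNReal.rpow_eq_zero_iff, this, h0]
  have hVtop : ∀ x ∈ Ioo 0 Φ, profileSpeed z t x ≠ ∞ := fun x hx => by
    have := (hsub x hx).2
    unfold profileSpeed
    finiteness
  set v : ℝ → ℝ := (Ioo 0 Φ).indicator fun x => (profileSpeed z t x).toReal with hv
  have hvm : Measurable v := hVm.ennreal_toReal.indicator measurableSet_Ioo
  have hv1 : ∀ x ∈ Ioo 0 Φ, ENNReal.ofReal (v x) = profileSpeed z t x := fun x hx => by
    rw [hv, indicator_of_mem hx, ENNReal.ofReal_toReal (hVtop x hx)]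
  have hvpos : ∀ x ∈ Ioo 0 Φ, 0 < v x := fun x hx => by
    rw [hv, indicator_of_mem hx]
    exact ENNReal.toReal_pos (hV0 x hx) (hVtop x hx)
  have hdiv : ∀ x ∈ Ioo 0 Φ,
      ENNReal.ofReal (x / v x) = ENNReal.ofReal x / profileSpeed z t x := fun x hx => by
    rw [ENNReal.ofReal_div_of_pos (hvpos x hx), hv1 x hx]
  set m := ∫⁻ x in Ioo 0 Φ, ENNReal.ofReal (x / v x) with hm
  have hm2 : 2 * m ≤ w := by
    rw [hm, setLIntegral_congr_fun measurableSet_Ioo hdiv]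
    exact hmass
  have hmtop : m ≠ ∞ := by
    intro h
    rw [h] at hm2
    simp at hm2
  have hm2r : 2 * m.toReal ≤ w := by
    have := ENNReal.toReal_mono (by finiteness) hm2
    simpa using this
  -- This half-length makes the plateau mass 2LΦ equal to the deficit w - 2m.
  have hL : 0 ≤ (w - 2 * m.toReal) / (2 * Φ) := div_nonneg (by linarith) (by linarith)
  obtain ⟨ψ, hψ, hE⟩ := exists_isPhaseField_of_speed hΦ hL hvm hvpos
    (fun x hx => indicator_of_notMem hx _) hmtop
  have hmasseq : 2 * m.toReal + 2 * ((w - 2 * m.toReal) / (2 * Φ)) * Φ = w := by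
    field_simp
    ring
  rw [← hm, hmasseq] at hψ
  refine (iInf₂_le ψ hψ).trans ?_
  rw [hE _ (measurable_phaseFieldCost hz) (phaseFieldCost_zero z)]
  set L := (w - 2 * m.toReal) / (2 * Φ) with hLdef
  have hc : phaseFieldCost z Φ.toNNReal ≤ t * ENNReal.ofReal Φ := by
    rw [mul_comm]
    exact mul_le_mul_right hzΦ _
  -- Equality in Young's inequality: v² = 2x(z - t) gives v/2 + xz/v = v + tx/v.
  have h1 : ∫⁻ x in Ioo 0 Φ, (ENNReal.ofReal (v x / 2) +
      phaseFieldCost z x.toNNReal * ENNReal.ofReal (v x)⁻¹) =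
      (∫⁻ x in Ioo 0 Φ, profileSpeed z t x) + t * m := by
    rw [hm, ← lintegral_const_mul' _ _ (by finiteness), ← lintegral_add_left hVm]
    refine setLIntegral_congr_fun measurableSet_Ioo fun x hx => ?_
    obtain ⟨b, hb⟩ : ∃ b : ℝ≥0, (b : ℝ≥0∞) = z x.toNNReal - t :=
      ⟨_, ENNReal.coe_toNNReal (hsub x hx).2⟩
    have hzb : z x.toNNReal = b + t := by
      rw [hb, tsub_add_cancel_of_le (hzlt x hx.1 hx.2).le]
    have hsq : v x ^ 2 = 2 * (x * b) := by
      have hx0 : 0 ≤ x := hx.1.le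
      rw [hv, indicator_of_mem hx, profileSpeed, ← hb, ← ENNReal.toReal_rpow, ← Real.sqrt_eq_rpow]
      simp only [ENNReal.toReal_mul, ENNReal.toReal_ofReal hx0, ENNReal.toReal_ofNat,
        ENNReal.coe_toReal]
      exact Real.sq_sqrt (by positivity)
    have hvx := hvpos x hx
    have hx0 : 0 < x := hx.1
    have hpc : phaseFieldCost z x.toNNReal = ENNReal.ofReal (x * (b + t)) := by
      rw [phaseFieldCost, hzb, ENNReal.ofReal_mul hx0.le,
        ENNReal.ofReal_add (by positivity) (by positivity)]
      simp [ENNReal.ofReal]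
    rw [hpc, ← hv1 x hx, ← ENNReal.ofReal_mul (by positivity),
      ← ENNReal.ofReal_add (by positivity) (by positivity), ← ENNReal.ofReal_coe_nnreal (p := t),
      ← ENNReal.ofReal_mul (by positivity), ← ENNReal.ofReal_add (by positivity) (by positivity)]
    congr 1
    field_simp
    linear_combination (-1 : ℝ) * hsq
  have hw : 2 * m + 2 * ENNReal.ofReal L * ENNReal.ofReal Φ = w := by
    rw [← ENNReal.ofReal_toReal hmtop, ← ENNReal.ofReal_ofNat 2,
      ← ENNReal.ofReal_mul (by positivity), ← ENNReal.ofReal_mul (by positivity),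
      ← ENNReal.ofReal_mul (by positivity), ← ENNReal.ofReal_add (by positivity) (by positivity),
      hmasseq, ENNReal.ofReal_coe_nnreal]
  calc _ ≤ 2 * ((∫⁻ x in Ioo 0 Φ, profileSpeed z t x) + t * m) +
        2 * ENNReal.ofReal L * (t * ENNReal.ofReal Φ) := by
        rw [h1]
        gcongr
    _ = 2 * (∫⁻ x in Ioo 0 Φ, profileSpeed z t x) +
        t * (2 * m + 2 * ENNReal.ofReal L * ENNReal.ofReal Φ) := by ring
    _ ≤ _ := by
        rw [hw]
        gcongr
        exact Ioo_subset_Ioi_self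

theorem ne_top_of_lintegral_profileSpeed_ne_top {z : ℝ≥0 → ℝ≥0∞} (hz : Antitone z) {t : ℝ≥0}
    (hfin : ∫⁻ x in Ioi 0, profileSpeed z t x ≠ ∞) {φ : ℝ≥0} (hφ : 0 < φ) : z φ ≠ ∞ := by
  intro h
  refine hfin (top_unique ?_)
  calc ∞ = ∫⁻ x in Ioo (0 : ℝ) φ, ∞ := by
        rw [setLIntegral_const, ENNReal.top_mul]
        simpa using hφ.ne'
    _ ≤ ∫⁻ x in Ioo (0 : ℝ) φ, profileSpeed z t x := by
        refine setLIntegral_mono' measurableSet_Ioo fun x hx => ?_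
        have h1 : z x.toNNReal = ∞ := top_unique (h ▸ hz (Real.toNNReal_le_iff_le_coe.2 hx.2.le))
        have h2 : 0 < x := hx.1
        simp [profileSpeed, h1, ENNReal.mul_top, h2]
    _ ≤ _ := lintegral_mono_set Ioo_subset_Ioi_self

/-- For x > 1 the speed is at most x √(2 z(1)), so the integrand stays above a positive constant on
a half-line. This rules out optimal profiles of unbounded height. -/
theorem lintegral_div_profileSpeed_eq_top {z : ℝ≥0 → ℝ≥0∞} (hz : Antitone z) (t : ℝ≥0)
    (h1 : z 1 ≠ ∞) : ∫⁻ x in Ioi 0, ENNReal.ofReal x / profileSpeed z t x = ∞ := by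
  set K : ℝ≥0∞ := (2 * z 1) ^ (1 / 2 : ℝ) with hK
  have hKtop : K ≠ ∞ := by rw [hK]; finiteness
  refine top_unique ?_
  calc ∞ = ∫⁻ x in Ioi (1 : ℝ), K⁻¹ := by
        rw [setLIntegral_const, Real.volume_Ioi, ENNReal.mul_top (ENNReal.inv_ne_zero.2 hKtop)]
    _ ≤ ∫⁻ x in Ioi (1 : ℝ), ENNReal.ofReal x / profileSpeed z t x := by
        refine setLIntegral_mono' measurableSet_Ioi fun x hx => ?_
        have hx1 : (1 : ℝ) < x := hx
        have hx0 : ENNReal.ofReal x ≠ 0 := by simpa using by linarith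
        have hx1' : 1 ≤ ENNReal.ofReal x := by simpa using hx1.le
        have hV : profileSpeed z t x ≤ ENNReal.ofReal x * K := by
          calc profileSpeed z t x ≤ (ENNReal.ofReal x ^ (2 : ℝ) * (2 * z 1)) ^ (1 / 2 : ℝ) := by
                unfold profileSpeed
                refine ENNReal.rpow_le_rpow ?_ (by norm_num)
                rw [mul_left_comm]
                gcongr
                · calc ENNReal.ofReal x = ENNReal.ofReal x ^ (1 : ℝ) := by simp
                    _ ≤ _ := ENNReal.rpow_le_rpow_of_exponent_le hx1' (by norm_num)
                · exact tsub_le_self.trans (hz (by simpa using hx1.le))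
            _ = _ := by
                rw [ENNReal.mul_rpow_of_nonneg _ _ (by norm_num), ← ENNReal.rpow_mul]
                norm_num [hK]
        calc K⁻¹ = ENNReal.ofReal x / (ENNReal.ofReal x * K) := by
              rw [ENNReal.div_eq_inv_mul, ENNReal.mul_inv (Or.inl hx0) (Or.inl (by finiteness)),
                mul_right_comm, ENNReal.inv_mul_cancel hx0 (by finiteness), one_mul]
          _ ≤ _ := ENNReal.div_le_div_left hV _
    _ ≤ _ := lintegral_mono_set (Ioi_subset_Ioi zero_le_one)

/-! ### Matching the two bounds. -/

theorem inducedCost_inverseCost_le {τ : ℝ≥0 → ℝ≥0} (hτ : IsAdmissible τ) {g : ℝ≥0 → ℝ≥0∞}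
    (hlsc : LowerSemicontinuous g) (hanti : Antitone g) (hconv : SolvesDeconvolution τ g)
    {w : ℝ≥0} (hw : 0 < w) : inducedCost (phaseFieldCost (inverseCost g)) w ≤ τ w := by
  obtain ⟨t, ht⟩ := hτ.exists_supergradient hw
  have hz := inverseCost_antitone g
  have hle := hconv.add_le ht
  rw [← two_mul_lintegral_profileSpeed_eq hlsc hanti] at hle
  have hge : ∀ s : ℝ≥0, (τ w : ℝ≥0∞) ≤
      2 * (∫⁻ x in Ioi 0, profileSpeed (inverseCost g) s x) + s * w := fun s => by
    rw [two_mul_lintegral_profileSpeed_eq hlsc hanti]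
    exact hconv.le_add s w
  have hmass := two_mul_lintegral_div_profileSpeed_le hz.measurable hle hge
  have hfin : ∫⁻ x in Ioi 0, profileSpeed (inverseCost g) t x ≠ ∞ := by
    intro h
    rw [h] at hle
    simp at hle
  have hzfin : ∀ φ, 0 < φ → inverseCost g φ ≠ ∞ := fun φ hφ =>
    ne_top_of_lintegral_profileSpeed_ne_top hz hfin hφ
  -- If g(t) were infinite, z would exceed t at every height and the optimal profile would have
  -- infinite mass, contradicting the bound by w.
  have hgt : g t ≠ ∞ := by
    intro h
    have hall : Ioi (0 : ℝ) ∩ {x : ℝ | (t : ℝ≥0∞) < inverseCost g x.toNNReal} = Ioi 0 := by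
      refine inter_eq_left.2 fun x _ => ?_
      change (t : ℝ≥0∞) < inverseCost g x.toNNReal
      rw [lt_inverseCost_iff hlsc hanti, h]
      exact ENNReal.coe_lt_top
    rw [hall, lintegral_div_profileSpeed_eq_top hz t (hzfin 1 one_pos)] at hmass
    simp at hmass
  obtain ⟨G, hG⟩ : ∃ G : ℝ≥0, (G : ℝ≥0∞) = g t := ⟨_, ENNReal.coe_toNNReal hgt⟩
  have hlt : ∀ φ : ℝ≥0, (t : ℝ≥0∞) < inverseCost g φ ↔ φ < G ^ (2 / 3 : ℝ) := by
    intro φ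
    rw [lt_inverseCost_iff hlsc hanti, ← hG, ENNReal.coe_lt_coe,
      ← NNReal.lt_rpow_inv_iff (by norm_num)]
    norm_num
  refine le_trans ?_ hle
  -- G^{2/3} is the top height Φ. If it is zero there is no ramp: z ≤ t everywhere, and long flat
  -- profiles reach tw in the limit.
  rcases eq_zero_or_pos (G ^ (2 / 3 : ℝ)) with h0 | h0
  · refine (inducedCost_le_mul hz.measurable hw fun φ => ?_).trans le_add_self
    rw [← not_lt, hlt, h0]
    exact not_lt_zero
  · refine inducedCost_le_of_profileSpeed hz.measurable (Φ := (G ^ (2 / 3 : ℝ) : ℝ≥0))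
      (by exact_mod_cast h0) hzfin ?_ ?_ ?_
    · rw [Real.toNNReal_coe, ← not_lt, hlt]
      exact lt_irrefl _
    · intro x hx hxΦ
      rw [hlt]
      exact (Real.toNNReal_lt_iff_lt_coe hx.le).2 hxΦ
    · refine le_trans ?_ hmass
      gcongr
      intro x hx
      refine ⟨hx.1, ?_⟩
      change (t : ℝ≥0∞) < inverseCost g x.toNNReal
      rw [hlt]
      exact (Real.toNNReal_lt_iff_lt_coe hx.1.le).2 hx.2

theorem le_inducedCost_inverseCost {τ : ℝ≥0 → ℝ≥0} {g : ℝ≥0 → ℝ≥0∞}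
    (hlsc : LowerSemicontinuous g) (hanti : Antitone g) (hconv : SolvesDeconvolution τ g)
    {w : ℝ≥0} (hw : 0 < w) : (τ w : ℝ≥0∞) ≤ inducedCost (phaseFieldCost (inverseCost g)) w := by
  refine le_iInf₂ fun ψ hψ => ?_
  by_cases hE : phaseFieldEnergy (phaseFieldCost (inverseCost g)) ψ = ∞
  · simp [hE]
  obtain ⟨t, ht⟩ := hψ.exists_le_phaseFieldEnergy (inverseCost_antitone g) hE hw.ne'
  rw [two_mul_lintegral_profileSpeed_eq hlsc hanti] at ht
  exact (hconv.le_add t w).trans ht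

theorem mainTheorem5 (τ : ℝ≥0 → ℝ≥0) (hτ : IsAdmissible τ)
    (g : ℝ≥0 → ℝ≥0∞) (hg_lsc : LowerSemicontinuous g) (hg_anti : Antitone g)
    (hconv : SolvesDeconvolution τ g) :
    ∀ w : ℝ≥0,
      inducedCostOfMassSpecific (fun φ : ℝ≥0 => genInverse g (φ ^ (3 / 2 : ℝ))) w
        = (τ w : ℝ≥0∞) := by
  intro w
  change inducedCost (phaseFieldCost (inverseCost g)) w = τ w
  rcases eq_zero_or_pos w with rfl | hw
  · rw [inducedCost_zero, hτ.map_zero, ENNReal.coe_zero]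
  · exact le_antisymm (inducedCost_inverseCost_le hτ hg_lsc hg_anti hconv hw)
      (le_inducedCost_inverseCost hg_lsc hg_anti hconv hw)
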